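/- Let $T$ be a finite set and $c\in\mathbb N$. A $T$-labelled partial order $\ell=(V,<,l)$ is finite, and it is a $c$-partial order if its Hasse diagram $\mathrm{tr}(\ell)$ is a union of $c$ (not necessarily disjoint or distinct) simple directed paths, single vertices being paths. DAGs are finite, have vertex labels in $T$, and may have parallel edges; DAGs and partial orders are taken up to isomorphism. A DAG is transitively reduced if no proper subgraph on the same vertices has the same transitive closure. MSO formulas over partial orders are built from $x\in X$, $x<y$, $l(x,a)$ ($a\in T$) by $\wedge,\vee,\neg$ and quantifiers $\exists x,\exists X$ over vertices and vertex sets; MSO$_2$ formulas over DAGs are built from $x\in X$, $y\in Y$, $s(y,x)$, $t(y,x)$ (source and target of an edge), $l(x,a)$ by $\wedge,\vee,\neg$ and existential quantifiers over vertices, edges, vertex sets and edge sets. A unit slice is a DAG with one center vertex labelled in $T$, in-frontier vertices $1,\dots,m$ and out-frontier vertices $1,\dots,n$, in which every frontier vertex is the endpoint of exactly one edge, and every edge starts in the in-frontier or the center and ends in the center or the out-frontier; its width is $\max(m,n)$. Slices are glued by fusing the edge ending at the $i$-th out-frontier vertex of the first with the edge starting at the $i$-th in-frontier vertex of the second. $\Sigma(c,T)$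 is the finite set of unit slices of width at most $c$ (up to isomorphism). A unit decomposition is a (possibly empty) sequence $U=S_1\cdots S_n$ of consecutively glueable unit slices, the first with empty in-frontier and the last with empty out-frontier, and $\mathring U=S_1\circ\dots\circ S_n$ is the DAG obtained by gluing. A slice automaton over $\Sigma(c,T)$ is a finite (nondeterministic) automaton over this alphabet with one initial state, in which transitions leaving the initial state carry slices with empty in-frontier, transitions entering a final state carry slices with empty out-frontier, and consecutive transitions carry glueable slices. A slice language $L$ is saturated if for every $U\in L$ all unit decompositions, of any width, of the DAG $\mathring U$ belong to $L$; it is transitively reduced if $\mathring U$ is transitively reduced for every $U\in L$; and $L_{po}$ is the set of transitive closures of the DAGs $\mathring U$, $U\in L$. An automaton is saturated or transitively reduced if its language is, and $L_{po}(\mathcal A)$ denotes $L(\mathcal A)_{po}$. Let $\varphi$ be an MSO sentence over $T$-labelled partial orders. Let $\varphi^{gr}$ be the MSO$_2$ sentence obtained from $\varphi$ by replacing each atom $x<x'$ by an MSO$_2$ formula saying that there is a path from $x$ to $x'\neq x$, and let $\rho$ and $\gamma(c)$ be the standard MSO$_2$ sentences expressing that a DAG is transitively reduced and that it is a union of $c$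 paths, respectively. Then $\ell\models\varphi$ if and only if $\mathrm{tr}(\ell)\models\varphi^{gr}$ for every $T$-labelled partial order $\ell$; a DAG satisfies $\rho$ if and only if it is transitively reduced; and it satisfies $\gamma(c)$ if and only if it is a union of $c$ paths. There is a slice automaton $\mathcal A(c,T,\varphi^{gr}\wedge\rho\wedge\gamma(c))$ over $\Sigma(c,T)$ that accepts exactly the unit decompositions $U$ over $\Sigma(c,T)$ with $\mathring U\models\varphi^{gr}\wedge\rho\wedge\gamma(c)$, and every such automaton is saturated and transitively reduced, and satisfies $$L_{po}\big(\mathcal A(c,T,\varphi^{gr}\wedge\rho\wedge\gamma(c))\big)=\mathcal P(c,T,\varphi),$$ the set of all $T$-labelled $c$-partial orders satisfying $\varphi$. -/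

import Mathlib

open Relation

universe u

/-! ### Labelled DAGs and labelled partial orders -/

/-- A finite `T`-labelled directed acyclic graph `(V, E, s, t, l)`. Parallel edges are allowed. -/
structure LDAG (T : Type u) where
  V : Type
  E : Type
  finV : Finite V
  finE : Finite E
  src : E → V
  tgt : E → V
  label : V → T
  acyclic : ∀ v, ¬ TransGen (fun a b => ∃ e, src e = a ∧ tgt e = b) v v

/-- A finite `T`-labelled partial order `(V, <, l)`, given by its strict order relation. -/
structure LPO (T : Type u) where
  V : Type
  finV : Finite V
  lt : V → V → Prop
  strict : IsStrictOrder V lt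
  label : V → T

namespace LDAG

variable {T : Type u}

/-- `u` and `v` are joined, in this direction, by an edge belonging to `F`. -/
def AdjOn (H : LDAG T) (F : Set H.E) (u v : H.V) : Prop :=
  ∃ e ∈ F, H.src e = u ∧ H.tgt e = v

/-- There is an edge from `u` to `v`. -/
def Adj (H : LDAG T) (u v : H.V) : Prop := ∃ e, H.src e = u ∧ H.tgt e = v

/-- Isomorphism of labelled DAGs. -/
structure Iso (H K : LDAG T) where
  vEquiv : H.V ≃ K.V
  eEquiv : H.E ≃ K.E
  src_eq : ∀ e, K.src (eEquiv e) = vEquiv (H.src e)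
  tgt_eq : ∀ e, K.tgt (eEquiv e) = vEquiv (H.tgt e)
  label_eq : ∀ v, K.label (vEquiv v) = H.label v

/-- The partial order obtained by transitive closure. -/
def tc (H : LDAG T) : LPO T where
  V := H.V
  finV := H.finV
  lt := TransGen H.Adj
  strict := { irrefl := H.acyclic, trans := fun _ _ _ => TransGen.trans }
  label := H.label

/-- `H` is its own transitive reduction: no proper subgraph (on the same vertices) has the same
transitive closure. -/
def IsTransReduced (H : LDAG T) : Prop :=
  ∀ F : Set H.E, (∀ u v, TransGen (H.AdjOn F) u v ↔ TransGen H.Adj u v) → F = Set.univ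

/-- `X` and `Y` are the vertex set and the edge set of a simple directed path from `a` to `b`.
A single vertex is a path. -/
def IsPathFromTo (H : LDAG T) (a b : H.V) (X : Set H.V) (Y : Set H.E) : Prop :=
  ∃ (k : ℕ) (v : Fin (k + 1) → H.V) (e : Fin k → H.E), Function.Injective v ∧
    (∀ i, H.src (e i) = v i.castSucc ∧ H.tgt (e i) = v i.succ) ∧
    v 0 = a ∧ v (Fin.last k) = b ∧ X = Set.range v ∧ Y = Set.range e

/-- `X` and `Y` are the vertex set and the edge set of a simple directed path. -/
def IsPath (H : LDAG T) (X : Set H.V) (Y : Set H.E) : Prop :=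
  ∃ a b, H.IsPathFromTo a b X Y

/-- `H` is the union of `c` (not necessarily disjoint or distinct) paths. -/
def CoverableBy (H : LDAG T) (c : ℕ) : Prop :=
  ∃ (X : Fin c → Set H.V) (Y : Fin c → Set H.E), (∀ i, H.IsPath (X i) (Y i)) ∧
    (∀ v, ∃ i, v ∈ X i) ∧ (∀ e, ∃ i, e ∈ Y i)

end LDAG

namespace LPO

variable {T : Type u}

/-- Isomorphism of labelled partial orders. -/
def IsIso (ℓ ℓ' : LPO T) : Prop :=
  ∃ f : ℓ.lt ≃r ℓ'.lt, ∀ v, ℓ'.label (f v) = ℓ.label v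

/-- The covering relation. -/
def Covers (ℓ : LPO T) (u v : ℓ.V) : Prop := ℓ.lt u v ∧ ¬ ∃ w, ℓ.lt u w ∧ ℓ.lt w v

/-- The Hasse diagram (transitive reduction) of a partial order. -/
def hasse (ℓ : LPO T) : LDAG T where
  V := ℓ.V
  E := {p : ℓ.V × ℓ.V // ℓ.Covers p.1 p.2}
  finV := ℓ.finV
  finE := by
    have := ℓ.finV
    infer_instance
  src := fun e => e.1.1
  tgt := fun e => e.1.2
  label := ℓ.label
  acyclic := by
    intro v hv
    have := ℓ.strict
    have key : ∀ w, TransGen (fun a b => ∃ e : {p : ℓ.V × ℓ.V // ℓ.Covers p.1 p.2},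
        e.1.1 = a ∧ e.1.2 = b) v w → ℓ.lt v w := by
      intro w hw
      induction hw with
      | single h => obtain ⟨e, rfl, rfl⟩ := h; exact e.2.1
      | tail _ h ih => obtain ⟨e, rfl, rfl⟩ := h; exact _root_.trans ih e.2.1
    exact irrefl_of ℓ.lt v (key v hv)

end LPO

/-! ### Monadic second order logic of partial orders -/

/-- MSO formulas over `T`-labelled partial orders, with `n` free vertex variables and `p` free
vertex set variables. Below a quantifier, variable `0` is the bound one and the old variables are
shifted by one. -/
inductive MSO (T : Type u) : ℕ → ℕ → Type u
  | mem {n p : ℕ} (x : Fin n) (X : Fin p) : MSO T n p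
  | lt {n p : ℕ} (x y : Fin n) : MSO T n p
  | lab {n p : ℕ} (x : Fin n) (a : T) : MSO T n p
  | and {n p : ℕ} (φ ψ : MSO T n p) : MSO T n p
  | or {n p : ℕ} (φ ψ : MSO T n p) : MSO T n p
  | not {n p : ℕ} (φ : MSO T n p) : MSO T n p
  | exV {n p : ℕ} (φ : MSO T (n + 1) p) : MSO T n p
  | exVS {n p : ℕ} (φ : MSO T n (p + 1)) : MSO T n p

/-- Truth of an MSO formula in a labelled partial order under an assignment. -/
def MSO.Sat {T : Type u} (ℓ : LPO T) :
    {n p : ℕ} → MSO T n p → (Fin n → ℓ.V) → (Fin p → Set ℓ.V) → Prop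
  | _, _, .mem x X, xs, Xs => xs x ∈ Xs X
  | _, _, .lt x y, xs, _ => ℓ.lt (xs x) (xs y)
  | _, _, .lab x a, xs, _ => ℓ.label (xs x) = a
  | _, _, .and φ ψ, xs, Xs => φ.Sat ℓ xs Xs ∧ ψ.Sat ℓ xs Xs
  | _, _, .or φ ψ, xs, Xs => φ.Sat ℓ xs Xs ∨ ψ.Sat ℓ xs Xs
  | _, _, .not φ, xs, Xs => ¬ φ.Sat ℓ xs Xs
  | _, _, .exV φ, xs, Xs => ∃ v, φ.Sat ℓ (Matrix.vecCons v xs) Xs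
  | _, _, .exVS φ, xs, Xs => ∃ A, φ.Sat ℓ xs (Matrix.vecCons A Xs)

/-- An MSO sentence is a formula without free variables. -/
abbrev MSOSentence (T : Type u) : Type u := MSO T 0 0

/-- A partial order satisfies a sentence. -/
def LPO.Models {T : Type u} (ℓ : LPO T) (φ : MSOSentence T) : Prop := φ.Sat ℓ ![] ![]

/-! ### Monadic second order logic of DAGs, with edge set quantification -/

/-- MSO₂ formulas over `T`-labelled DAGs with `n` free vertex variables, `m` free edge variables,
`p` free vertex set variables and `q` free edge set variables. Below a quantifier, variable `0` of
its sort is the bound one and the old variables of that sort are shifted by one. -/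
inductive MSO₂ (T : Type u) : ℕ → ℕ → ℕ → ℕ → Type u
  | memV {n m p q : ℕ} (x : Fin n) (X : Fin p) : MSO₂ T n m p q
  | memE {n m p q : ℕ} (y : Fin m) (Y : Fin q) : MSO₂ T n m p q
  | src {n m p q : ℕ} (y : Fin m) (x : Fin n) : MSO₂ T n m p q
  | tgt {n m p q : ℕ} (y : Fin m) (x : Fin n) : MSO₂ T n m p q
  | lab {n m p q : ℕ} (x : Fin n) (a : T) : MSO₂ T n m p q
  | and {n m p q : ℕ} (φ ψ : MSO₂ T n m p q) : MSO₂ T n m p q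
  | or {n m p q : ℕ} (φ ψ : MSO₂ T n m p q) : MSO₂ T n m p q
  | not {n m p q : ℕ} (φ : MSO₂ T n m p q) : MSO₂ T n m p q
  | exV {n m p q : ℕ} (φ : MSO₂ T (n + 1) m p q) : MSO₂ T n m p q
  | exE {n m p q : ℕ} (φ : MSO₂ T n (m + 1) p q) : MSO₂ T n m p q
  | exVS {n m p q : ℕ} (φ : MSO₂ T n m (p + 1) q) : MSO₂ T n m p q
  | exES {n m p q : ℕ} (φ : MSO₂ T n m p (q + 1)) : MSO₂ T n m p q

/-- Truth of an MSO₂ formula in a labelled DAG under an assignment. -/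
def MSO₂.Sat {T : Type u} (H : LDAG T) : {n m p q : ℕ} → MSO₂ T n m p q →
    (Fin n → H.V) → (Fin m → H.E) → (Fin p → Set H.V) → (Fin q → Set H.E) → Prop
  | _, _, _, _, .memV x X, xs, _, Xs, _ => xs x ∈ Xs X
  | _, _, _, _, .memE y Y, _, ys, _, Ys => ys y ∈ Ys Y
  | _, _, _, _, .src y x, xs, ys, _, _ => H.src (ys y) = xs x
  | _, _, _, _, .tgt y x, xs, ys, _, _ => H.tgt (ys y) = xs x
  | _, _, _, _, .lab x a, xs, _, _, _ => H.label (xs x) = a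
  | _, _, _, _, .and φ ψ, xs, ys, Xs, Ys => φ.Sat H xs ys Xs Ys ∧ ψ.Sat H xs ys Xs Ys
  | _, _, _, _, .or φ ψ, xs, ys, Xs, Ys => φ.Sat H xs ys Xs Ys ∨ ψ.Sat H xs ys Xs Ys
  | _, _, _, _, .not φ, xs, ys, Xs, Ys => ¬ φ.Sat H xs ys Xs Ys
  | _, _, _, _, .exV φ, xs, ys, Xs, Ys => ∃ v, φ.Sat H (Matrix.vecCons v xs) ys Xs Ys
  | _, _, _, _, .exE φ, xs, ys, Xs, Ys => ∃ e, φ.Sat H xs (Matrix.vecCons e ys) Xs Ys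
  | _, _, _, _, .exVS φ, xs, ys, Xs, Ys => ∃ A, φ.Sat H xs ys (Matrix.vecCons A Xs) Ys
  | _, _, _, _, .exES φ, xs, ys, Xs, Ys => ∃ B, φ.Sat H xs ys Xs (Matrix.vecCons B Ys)

/-- An MSO₂ sentence is a formula without free variables. -/
abbrev MSO₂Sentence (T : Type u) : Type u := MSO₂ T 0 0 0 0

/-- A DAG satisfies a sentence. -/
def LDAG.Models {T : Type u} (H : LDAG T) (φ : MSO₂Sentence T) : Prop := φ.Sat H ![] ![] ![] ![]

namespace MSO₂

variable {T : Type u} {n m p q : ℕ}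

def imp (φ ψ : MSO₂ T n m p q) : MSO₂ T n m p q := .or (.not φ) ψ

def allV (φ : MSO₂ T (n + 1) m p q) : MSO₂ T n m p q := .not (.exV (.not φ))

def allE (φ : MSO₂ T n (m + 1) p q) : MSO₂ T n m p q := .not (.exE (.not φ))

/-- Equality of vertices: every vertex set containing `x` contains `x'`. -/
def eqV (x x' : Fin n) : MSO₂ T n m p q := .not (.exVS (.and (.memV x 0) (.not (.memV x' 0))))

/-- Equality of edges: every edge set containing `y` contains `y'`. -/
def eqE (y y' : Fin m) : MSO₂ T n m p q := .not (.exES (.and (.memE y 0) (.not (.memE y' 0))))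

def fls : MSO₂ T n m p q := .exVS (.exV (.and (.memV 0 0) (.not (.memV 0 0))))

/-- Finite conjunction. -/
def bigAnd {c : ℕ} (φ : Fin c → MSO₂ T n m p q) : MSO₂ T n m p q :=
  (List.ofFn φ).foldr .and (.not fls)

/-- Finite disjunction. -/
def bigOr {c : ℕ} (φ : Fin c → MSO₂ T n m p q) : MSO₂ T n m p q :=
  (List.ofFn φ).foldr .or fls

/-- Existential quantification over all vertex set variables. -/
def exVSs : (p : ℕ) → MSO₂ T n m p q → MSO₂ T n m 0 q
  | 0, φ => φ
  | p + 1, φ => exVSs p (.exVS φ)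

/-- Existential quantification over all edge set variables. -/
def exESs : (q : ℕ) → MSO₂ T n m p q → MSO₂ T n m p 0
  | 0, φ => φ
  | q + 1, φ => exESs q (.exES φ)

/-- `path(x, X, Y, x')`: in a DAG, `X` and `Y` are the vertex set and the edge set of a directed
path from `x` to `x'`. The conjuncts say, in this order: `x` and `x'` belong to `X`; the endpoints
of every edge in `Y` belong to `X`; edges of `Y` with the same source, or with the same target, are
equal; every vertex in `X` other than `x'` is the source of an edge in `Y`; every vertex in `X`
other than `x` is the target of an edge in `Y`; no edge in `Y` has target `x` or source `x'`. -/
def path (x x' : Fin n) (X : Fin p) (Y : Fin q) : MSO₂ T n m p q :=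
  .and (.and (.memV x X) (.memV x' X)) <|
  .and (allE (allV (imp (.and (.memE 0 Y) (.or (.src 0 0) (.tgt 0 0))) (.memV 0 X)))) <|
  .and (allE (allE (allV (imp
    (.and (.and (.memE 0 Y) (.memE 1 Y))
      (.or (.and (.src 0 0) (.src 1 0)) (.and (.tgt 0 0) (.tgt 1 0))))
    (eqE 0 1))))) <|
  .and (allV (imp (.memV 0 X) (.or (eqV 0 x'.succ) (.exE (.and (.memE 0 Y) (.src 0 0)))))) <|
  .and (allV (imp (.memV 0 X) (.or (eqV 0 x.succ) (.exE (.and (.memE 0 Y) (.tgt 0 0)))))) <|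
  .not (.exE (.and (.memE 0 Y) (.or (.tgt 0 x) (.src 0 x'))))

/-- The sentence saying that a DAG is transitively reduced: no edge can be bypassed by a path that
does not use it. -/
def rho : MSO₂Sentence T :=
  .not (.exE (.exV (.exV (.and (.and (.src 0 0) (.tgt 0 1))
    (.exVS (.exES (.and (path 0 1 0 0) (.not (.memE 0 0)))))))))

/-- The sentence saying that a DAG can be covered by `c` paths. -/
def gamma (c : ℕ) : MSO₂Sentence T :=
  exVSs c <| exESs c <|
    .and (bigAnd fun i : Fin c => .exV (.exV (path 0 1 i i))) <|
    .and (allV (bigOr fun i : Fin c => .memV 0 i)) (allE (bigOr fun i : Fin c => .memE 0 i))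

end MSO₂

/-- The translation of MSO formulas over partial orders into MSO₂ formulas over Hasse diagrams:
`x < x'` is replaced by the existence of a path from `x` to `x' ≠ x`. -/
def MSO.gr {T : Type u} : {n p : ℕ} → MSO T n p → MSO₂ T n 0 p 0
  | _, _, .mem x X => .memV x X
  | _, _, .lt x x' => .exVS (.exES (.and (MSO₂.path x x' 0 0) (.not (MSO₂.eqV x x'))))
  | _, _, .lab x a => .lab x a
  | _, _, .and φ ψ => .and φ.gr ψ.gr
  | _, _, .or φ ψ => .or φ.gr ψ.gr
  | _, _, .not φ => .not φ.gr
  | _, _, .exV φ => .exV φ.gr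
  | _, _, .exVS φ => .exVS φ.gr

/-! ### Slices and unit decompositions -/

/-- A slice with in-frontier `Fin inn`, center `C` and out-frontier `Fin out`; the numbering of
the frontier vertices is built in. Edges start in the in-frontier or the center and end in the
center or the out-frontier. -/
structure Slice (T : Type u) where
  inn : ℕ
  out : ℕ
  C : Type
  E : Type
  finC : Finite C
  finE : Finite E
  src : E → Fin inn ⊕ C
  tgt : E → C ⊕ Fin out
  label : C → T
  in_unique : ∀ i, ∃! e, src e = .inl i
  out_unique : ∀ j, ∃! e, tgt e = .inr j
  acyclic : ∀ v, ¬ TransGen (fun a b => ∃ e, src e = .inr a ∧ tgt e = .inl b) v v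

namespace Slice

variable {T : Type u}

/-- The slice without vertices. -/
def empty : Slice T where
  inn := 0
  out := 0
  C := Empty
  E := Empty
  finC := inferInstance
  finE := inferInstance
  src := Empty.elim
  tgt := Empty.elim
  label := Empty.elim
  in_unique := fun i => i.elim0
  out_unique := fun i => i.elim0
  acyclic := fun v => v.elim

/-- The edges `e` and `e'` are to be fused when gluing: `e` ends in the out-frontier vertex of `S`
and `e'` starts in the in-frontier vertex of `S'` with the same number. -/
def Fused (S S' : Slice T) (h : S.out = S'.inn) (e : S.E) (e' : S'.E) : Prop :=
  ∃ i : Fin S.out, S.tgt e = .inr i ∧ S'.src e' = .inl (i.cast h)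

/-- A relation on a disjoint union which never goes back from the second part to the first is
acyclic if it is contained in acyclic relations on both parts. -/
theorem acyclic_sum {α β : Type} (r : α ⊕ β → α ⊕ β → Prop) (r₁ : α → α → Prop)
    (r₂ : β → β → Prop) (h₁ : ∀ a, ¬ TransGen r₁ a a) (h₂ : ∀ b, ¬ TransGen r₂ b b)
    (hl : ∀ a b, r (.inl a) (.inl b) → r₁ a b) (hr : ∀ a b, r (.inr a) (.inr b) → r₂ a b)
    (hn : ∀ a b, ¬ r (.inr a) (.inl b)) (v : α ⊕ β) : ¬ TransGen r v v := by
  have key : ∀ x y, TransGen r x y → (∀ a b, x = .inl a → y = .inl b → TransGen r₁ a b) ∧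
      (∀ a b, x = .inr a → y = .inr b → TransGen r₂ a b) ∧
      (∀ a b, x = .inr a → y ≠ .inl b) := by
    intro x y hxy
    induction hxy with
    | single h =>
      refine ⟨?_, ?_, ?_⟩
      · rintro a b rfl rfl; exact .single (hl _ _ h)
      · rintro a b rfl rfl; exact .single (hr _ _ h)
      · rintro a b rfl rfl; exact hn _ _ h
    | @tail y z _ h ih =>
      obtain ⟨i1, i2, i3⟩ := ih
      refine ⟨?_, ?_, ?_⟩
      · rintro a b rfl rfl
        rcases y with y | y
        · exact (i1 _ _ rfl rfl).tail (hl _ _ h)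
        · exact (hn _ _ h).elim
      · rintro a b rfl rfl
        rcases y with y | y
        · exact (i3 _ _ rfl rfl).elim
        · exact (i2 _ _ rfl rfl).tail (hr _ _ h)
      · rintro a b rfl rfl
        rcases y with y | y
        · exact i3 _ _ rfl rfl
        · exact hn _ _ h
  intro hv
  rcases v with v | v
  · exact h₁ v ((key _ _ hv).1 _ _ rfl rfl)
  · exact h₂ v ((key _ _ hv).2.1 _ _ rfl rfl)

/-- Gluing `S ∘ S'`. The edges are those of `S` not ending in the out-frontier, one edge for each
pair of fused edges, and those of `S'` not starting in the in-frontier. -/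
def glue (S S' : Slice T) (h : S.out = S'.inn) : Slice T where
  inn := S.inn
  out := S'.out
  C := S.C ⊕ S'.C
  E := {e : S.E // (S.tgt e).isLeft} ⊕ {p : S.E × S'.E // Fused S S' h p.1 p.2} ⊕
    {e' : S'.E // (S'.src e').isRight}
  finC := by
    have := S.finC
    have := S'.finC
    infer_instance
  finE := by
    have := S.finE
    have := S'.finE
    infer_instance
  src
    | .inl e => (S.src e.1).map id .inl
    | .inr (.inl p) => (S.src p.1.1).map id .inl
    | .inr (.inr e') => .inr (.inr ((S'.src e'.1).getRight e'.2))
  tgt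
    | .inl e => .inl (.inl ((S.tgt e.1).getLeft e.2))
    | .inr (.inl p) => (S'.tgt p.1.2).map .inr id
    | .inr (.inr e') => (S'.tgt e'.1).map .inr id
  label := Sum.elim S.label S'.label
  in_unique := by
    intro i
    obtain ⟨e, he, hu⟩ := S.in_unique i
    have hsrc : ∀ x, Sum.map id (Sum.inl : S.C → S.C ⊕ S'.C) x = .inl i → x = .inl i := by
      rintro (x | x) hx <;> simp_all
    rcases ht : S.tgt e with v | j
    · refine ⟨.inl ⟨e, by simp [ht]⟩, by simp [he], ?_⟩
      rintro (⟨f, hf'⟩ | ⟨⟨f, f'⟩, j, hj, hj'⟩ | f) hf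
      · obtain rfl := hu f (hsrc _ hf)
        rfl
      · obtain rfl := hu f (hsrc _ hf)
        simp [ht] at hj
      · simp at hf
    · obtain ⟨e', he', hu'⟩ := S'.in_unique (j.cast h)
      refine ⟨.inr (.inl ⟨(e, e'), j, ht, he'⟩), by simp [he], ?_⟩
      rintro (⟨f, hf'⟩ | ⟨⟨f, f'⟩, k, hk, hk'⟩ | f) hf
      · obtain rfl := hu f (hsrc _ hf)
        simp [ht] at hf'
      · obtain rfl := hu f (hsrc _ hf)
        dsimp only at hk hk'
        rw [ht, Sum.inr.injEq] at hk
        subst hk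
        obtain rfl := hu' f' hk'
        rfl
      · simp at hf
  out_unique := by
    intro i
    obtain ⟨e', he', hu'⟩ := S'.out_unique i
    have htgt : ∀ x, Sum.map (Sum.inr : S'.C → S.C ⊕ S'.C) id x = .inr i → x = .inr i := by
      rintro (x | x) hx <;> simp_all
    rcases hs : S'.src e' with j | v
    · obtain ⟨e, he, hu⟩ := S.out_unique (j.cast h.symm)
      refine ⟨.inr (.inl ⟨(e, e'), j.cast h.symm, he, by simpa using hs⟩), by simp [he'], ?_⟩
      rintro (f | ⟨⟨f, f'⟩, k, hk, hk'⟩ | ⟨f, hf'⟩) hf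
      · simp at hf
      · obtain rfl := hu' f' (htgt _ hf)
        dsimp only at hk hk'
        rw [hs, Sum.inl.injEq] at hk'
        subst hk'
        obtain rfl := hu f (by simpa using hk)
        rfl
      · obtain rfl := hu' f (htgt _ hf)
        simp [hs] at hf'
    · refine ⟨.inr (.inr ⟨e', by simp [hs]⟩), by simp [he'], ?_⟩
      rintro (f | ⟨⟨f, f'⟩, k, hk, hk'⟩ | ⟨f, hf'⟩) hf
      · simp at hf
      · obtain rfl := hu' f' (htgt _ hf)
        simp [hs] at hk'
      · obtain rfl := hu' f (htgt _ hf)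
        rfl
  acyclic := by
    refine acyclic_sum _ _ _ S.acyclic S'.acyclic ?_ ?_ ?_
    · rintro a b ⟨e | ⟨⟨e, e'⟩, i, hi⟩ | e, h1, h2⟩
      · refine ⟨e.1, ?_, ?_⟩
        · rcases hs : S.src e.1 with x | x <;> simp_all
        · rcases ht : S.tgt e.1 with x | x
          · simp_all
          · have := e.2
            simp [ht] at this
      · rcases ht : S'.tgt e' with x | x <;> simp_all
      · simp at h1
    · rintro a b ⟨e | ⟨⟨e, e'⟩, i, hi⟩ | e, h1, h2⟩
      · simp at h2
      · rcases hs : S.src e with x | x <;> simp_all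
      · refine ⟨e.1, ?_, ?_⟩
        · rcases hs : S'.src e.1 with x | x
          · have := e.2
            simp [hs] at this
          · simp_all
        · rcases ht : S'.tgt e.1 with x | x <;> simp_all
    · rintro a b ⟨e | ⟨⟨e, e'⟩, i, hi⟩ | e, h1, h2⟩
      · rcases hs : S.src e.1 with x | x <;> simp_all
      · rcases hs : S.src e with x | x <;> simp_all
      · rcases ht : S'.tgt e.1 with x | x <;> simp_all

/-- The DAG on the center vertices; edges touching a frontier are disregarded (there are none when
both frontiers are empty). -/
def toLDAG (S : Slice T) : LDAG T where
  V := S.C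
  E := {p : S.E × S.C × S.C // S.src p.1 = .inr p.2.1 ∧ S.tgt p.1 = .inl p.2.2}
  finV := S.finC
  finE := by
    have := S.finC
    have := S.finE
    infer_instance
  src := fun p => p.1.2.1
  tgt := fun p => p.1.2.2
  label := S.label
  acyclic := by
    intro v hv
    refine S.acyclic v (TransGen.mono ?_ _ _ hv)
    rintro a b ⟨⟨⟨e, x, y⟩, h1, h2⟩, rfl, rfl⟩
    exact ⟨e, h1, h2⟩

end Slice

/-- A unit slice up to isomorphism, with center vertex labelled by `label`: an in-frontier vertex
`i` with `pass i = some j` is joined to the out-frontier vertex `j`, every other in-frontier vertex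
is joined to the center, and the center is joined to every remaining out-frontier vertex. -/
structure UnitSlice (T : Type u) where
  inn : ℕ
  out : ℕ
  label : T
  pass : Fin inn ≃. Fin out

namespace UnitSlice

variable {T : Type u}

/-- The slice described by a `UnitSlice`. -/
def toSlice (S : UnitSlice T) : Slice T where
  inn := S.inn
  out := S.out
  C := Unit
  E := Fin S.inn ⊕ {j : Fin S.out // S.pass.symm j = none}
  finC := inferInstance
  finE := inferInstance
  src
    | .inl i => .inl i
    | .inr _ => .inr ()
  tgt
    | .inl i => match S.pass i with
      | some j => .inr j
      | none => .inl ()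
    | .inr j => .inr j.1
  label := fun _ => S.label
  in_unique := by
    intro i
    refine ⟨.inl i, rfl, ?_⟩
    rintro (k | k) hk
    · simpa using hk
    · simp at hk
  out_unique := by
    intro j
    rcases hj : S.pass.symm j with - | i
    · refine ⟨.inr ⟨j, hj⟩, rfl, ?_⟩
      rintro (k | k) hk
      · rcases hp : S.pass k with - | j'
        · simp [hp] at hk
        · simp only [hp, Sum.inr.injEq] at hk
          subst hk
          have := (PEquiv.eq_some_iff S.pass).2 hp
          simp_all
      · simp only [Sum.inr.injEq] at hk
        subst hk
        rfl
    · have hi := (PEquiv.eq_some_iff S.pass).1 hj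
      refine ⟨.inl i, by simp [hi], ?_⟩
      rintro (k | k) hk
      · rcases hp : S.pass k with - | j'
        · simp [hp] at hk
        · simp only [hp, Sum.inr.injEq] at hk
          subst hk
          have := (PEquiv.eq_some_iff S.pass).2 hp
          simp_all
      · simp only [Sum.inr.injEq] at hk
        subst hk
        have := k.2
        simp_all
  acyclic := by
    intro v hv
    obtain ⟨c, -, e | e, h1, h2⟩ := TransGen.tail'_iff.1 hv
    · simp at h1
    · simp at h2

def width (S : UnitSlice T) : ℕ := max S.inn S.out

end UnitSlice

/-- The slice alphabet `Σ(c, T)`. -/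
def sliceAlphabet (c : ℕ) (T : Type u) : Set (UnitSlice T) := {S | S.width ≤ c}

/-- A unit decomposition over an arbitrary width: a sequence of consecutively composable unit
slices whose first slice is initial and whose last slice is final. -/
structure IsUnitDecomposition {T : Type u} (U : List (UnitSlice T)) : Prop where
  chain : U.IsChain fun S S' => S.out = S'.inn
  initial : ∀ S ∈ U.head?, S.inn = 0
  final : ∀ S ∈ U.getLast?, S.out = 0

/-- `S₁ ∘ S₂ ∘ ⋯ ∘ Sₙ`, for composable sequences ending in a final slice. -/
def composedSlice {T : Type u} : List (UnitSlice T) → Slice T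
  | [] => Slice.empty
  | S :: U =>
    if h : S.out = (composedSlice U).inn then S.toSlice.glue (composedSlice U) h else Slice.empty

/-- The DAG obtained from a unit decomposition by composing its slices. -/
def composed {T : Type u} (U : List (UnitSlice T)) : LDAG T := (composedSlice U).toLDAG

/-- The set of all unit decompositions over `Σ(c, T)`. -/
def unitDecompositions (c : ℕ) (T : Type u) : Set (List (UnitSlice T)) :=
  {U | (∀ S ∈ U, S ∈ sliceAlphabet c T) ∧ IsUnitDecomposition U}

/-- The unit decompositions of width at most `c` of the DAG `H` (up to isomorphism). -/
def udWidth {T : Type u} (H : LDAG T) (c : ℕ) : Set (List (UnitSlice T)) :=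
  {U ∈ unitDecompositions c T | Nonempty ((composed U).Iso H)}

/-- The set of all unit decompositions of `H`. -/
def ud {T : Type u} (H : LDAG T) : Set (List (UnitSlice T)) := ⋃ c, udWidth H c

/-! ### Slice languages -/

/-- The DAGs represented by a slice language (closed under isomorphism). -/
def graphLanguage {T : Type u} (L : Set (List (UnitSlice T))) : Set (LDAG T) :=
  {H | ∃ U ∈ L, Nonempty ((composed U).Iso H)}

/-- The partial orders represented by a slice language (closed under isomorphism). -/
def poLanguage {T : Type u} (L : Set (List (UnitSlice T))) : Set (LPO T) :=
  {ℓ | ∃ U ∈ L, (composed U).tc.IsIso ℓ}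

def IsSaturatedLanguage {T : Type u} (L : Set (List (UnitSlice T))) : Prop :=
  ∀ H ∈ graphLanguage L, ud H ⊆ L

def IsTransReducedLanguage {T : Type u} (L : Set (List (UnitSlice T))) : Prop :=
  ∀ H ∈ graphLanguage L, H.IsTransReduced

/-- A slice automaton over `Σ(c, T)`. -/
structure SliceAutomaton (c : ℕ) (T : Type u) where
  Q : Type
  finQ : Finite Q
  Δ : Set (Q × UnitSlice T × Q)
  q₀ : Q
  F : Set Q
  alphabet : ∀ q S q', (q, S, q') ∈ Δ → S ∈ sliceAlphabet c T
  initial : ∀ S q, (q₀, S, q) ∈ Δ → S.inn = 0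
  final : ∀ q S q', (q, S, q') ∈ Δ → q' ∈ F → S.out = 0
  glue : ∀ q S q' S' q'', (q, S, q') ∈ Δ → (q', S', q'') ∈ Δ → S.out = S'.inn

namespace SliceAutomaton

variable {T : Type u} {c : ℕ}

/-- The underlying nondeterministic automaton. -/
def toNFA (A : SliceAutomaton c T) : NFA (UnitSlice T) A.Q where
  step := fun q S => {q' | (q, S, q') ∈ A.Δ}
  start := {A.q₀}
  accept := A.F

/-- The slice language accepted by a slice automaton. -/
def lang (A : SliceAutomaton c T) : Set (List (UnitSlice T)) := {U | U ∈ A.toNFA.accepts}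

def IsSaturated (A : SliceAutomaton c T) : Prop := IsSaturatedLanguage A.lang

def IsTransReduced (A : SliceAutomaton c T) : Prop := IsTransReducedLanguage A.lang

/-- `A` is a slice automaton `𝒜(c, T, ψ)`: it accepts exactly the unit decompositions over
`Σ(c, T)` whose composed DAG satisfies `ψ`. -/
def Defines (A : SliceAutomaton c T) (ψ : MSO₂Sentence T) : Prop :=
  A.lang = {U ∈ unitDecompositions c T | (composed U).Models ψ}

end SliceAutomaton

/-- `𝒫(c, T, φ)`: the `T`-labelled partial orders satisfying `φ` whose Hasse diagram can be covered
by `c` paths. -/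
def cPartialOrders (c : ℕ) (T : Type u) (φ : MSOSentence T) : Set (LPO T) :=
  {ℓ | ℓ.hasse.CoverableBy c ∧ ℓ.Models φ}

/-! A partial order and its Hasse diagram determine each other, and the Hasse diagrams are the
transitively reduced DAGs; since `MSO₂.path` describes paths locally, the three sentences mean what
they should. A path crosses each frontier of a unit decomposition at most once, so all unit
decompositions of a DAG covered by `c` paths have width at most `c`; this gives saturation, as every
DAG has a unit decomposition along a topological order of its vertices.

For the existence of the automaton, an assignment is recorded by marking the slices: vertices by the
slice they are the center of, edges by the slice whose center they leave. As for Büchi's theorem,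
the truth of an MSO₂ formula is a regular property of the marked decomposition, by induction on the
formula. Only the atom `tgt y x` needs memory: from right to left, the automaton keeps track of the
frontier vertices from which an edge leads to `x`. -/

/-! ## Finite acyclic relations -/

theorem wellFounded_of_forall_not_transGen {α : Type*} [Finite α] {r : α → α → Prop}
    (hr : ∀ a, ¬ TransGen r a a) : WellFounded r :=
  have : Std.Irrefl (TransGen r) := ⟨hr⟩
  Subrelation.wf TransGen.single (Finite.wellFounded_of_trans_of_irrefl (TransGen r))

theorem exists_equivFin_of_forall_not_transGen {α : Type*} [Finite α] {r : α → α → Prop}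
    (hr : ∀ a, ¬ TransGen r a a) :
    ∃ (n : ℕ) (pos : α ≃ Fin n), ∀ a b, r a b → pos a < pos b := by
  let : PartialOrder α :=
    { le := ReflTransGen r
      le_refl := fun _ => .refl
      le_trans := fun _ _ _ => ReflTransGen.trans
      le_antisymm := fun a b hab hba =>
        ((reflTransGen_iff_eq_or_transGen.1 hab).resolve_right
          fun h => hr a (h.trans_left hba)).symm }
  have : Finite (LinearExtension α) := inferInstanceAs (Finite α)
  have := Fintype.ofFinite (LinearExtension α)
  let pos := (Fintype.orderIsoFinOfCardEq (LinearExtension α) rfl).symm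
  refine ⟨_, pos.toEquiv, fun a b hab => pos.lt_iff_lt.2 (lt_of_le_of_ne ?_ ?_)⟩
  · exact toLinearExtension.monotone (ReflTransGen.single hab)
  · rintro rfl
    exact hr a (.single hab)

/-! ## Truth of derived formulas -/

namespace MSO₂

variable {T : Type u} {n m p q : ℕ} (H : LDAG T) (xs : Fin n → H.V) (ys : Fin m → H.E)
  (Xs : Fin p → Set H.V) (Ys : Fin q → Set H.E)

theorem sat_imp (φ ψ : MSO₂ T n m p q) :
    (imp φ ψ).Sat H xs ys Xs Ys ↔ (φ.Sat H xs ys Xs Ys → ψ.Sat H xs ys Xs Ys) := by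
  simp only [imp, Sat, imp_iff_not_or]

theorem sat_allV (φ : MSO₂ T (n + 1) m p q) :
    (allV φ).Sat H xs ys Xs Ys ↔ ∀ v, φ.Sat H (Matrix.vecCons v xs) ys Xs Ys := by
  simp [allV, Sat]

theorem sat_allE (φ : MSO₂ T n (m + 1) p q) :
    (allE φ).Sat H xs ys Xs Ys ↔ ∀ e, φ.Sat H xs (Matrix.vecCons e ys) Xs Ys := by
  simp [allE, Sat]

theorem sat_eqV (x x' : Fin n) :
    (eqV x x' : MSO₂ T n m p q).Sat H xs ys Xs Ys ↔ xs x = xs x' := by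
  simp only [eqV, Sat, Matrix.cons_val_zero, not_exists, not_and, not_not]
  exact ⟨fun h => (h {xs x} rfl).symm, fun h A hA => h ▸ hA⟩

theorem sat_eqE (y y' : Fin m) :
    (eqE y y' : MSO₂ T n m p q).Sat H xs ys Xs Ys ↔ ys y = ys y' := by
  simp only [eqE, Sat, Matrix.cons_val_zero, not_exists, not_and, not_not]
  exact ⟨fun h => (h {ys y} rfl).symm, fun h A hA => h ▸ hA⟩

theorem not_sat_fls : ¬ (fls : MSO₂ T n m p q).Sat H xs ys Xs Ys := by
  simp [fls, Sat]

theorem sat_foldr_and (L : List (MSO₂ T n m p q)) :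
    (L.foldr (β := MSO₂ T n m p q) .and (.not fls)).Sat H xs ys Xs Ys ↔
      ∀ ψ ∈ L, ψ.Sat H xs ys Xs Ys := by
  induction L with
  | nil => simpa [Sat] using not_sat_fls H xs ys Xs Ys
  | cons ψ L ih => simp [Sat, ih]

theorem sat_foldr_or (L : List (MSO₂ T n m p q)) :
    (L.foldr (β := MSO₂ T n m p q) .or fls).Sat H xs ys Xs Ys ↔
      ∃ ψ ∈ L, ψ.Sat H xs ys Xs Ys := by
  induction L with
  | nil => simpa using not_sat_fls H xs ys Xs Ys
  | cons ψ L ih => simp [Sat, ih]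

theorem sat_bigAnd {c : ℕ} (φ : Fin c → MSO₂ T n m p q) :
    (bigAnd φ).Sat H xs ys Xs Ys ↔ ∀ i, (φ i).Sat H xs ys Xs Ys := by
  rw [bigAnd, sat_foldr_and, List.forall_mem_ofFn_iff]

theorem sat_bigOr {c : ℕ} (φ : Fin c → MSO₂ T n m p q) :
    (bigOr φ).Sat H xs ys Xs Ys ↔ ∃ i, (φ i).Sat H xs ys Xs Ys := by
  simp [bigOr, sat_foldr_or, List.mem_ofFn]

theorem sat_exVSs (φ : MSO₂ T n m p q) :
    (exVSs p φ).Sat H xs ys ![] Ys ↔ ∃ Xs, φ.Sat H xs ys Xs Ys := by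
  induction p with
  | zero => exact (Unique.exists_iff (p := fun Xs => φ.Sat H xs ys Xs Ys)).symm
  | succ p ih =>
    simp only [exVSs, ih, Sat]
    exact (exists_comm.trans (Fin.exists_fin_succ_pi (P := fun Xs => φ.Sat H xs ys Xs Ys)).symm)

theorem sat_exESs (φ : MSO₂ T n m p q) :
    (exESs q φ).Sat H xs ys Xs ![] ↔ ∃ Ys, φ.Sat H xs ys Xs Ys := by
  induction q with
  | zero => exact (Unique.exists_iff (p := fun Ys => φ.Sat H xs ys Xs Ys)).symm
  | succ q ih =>
    simp only [exESs, ih, Sat]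
    exact (exists_comm.trans (Fin.exists_fin_succ_pi (P := fun Ys => φ.Sat H xs ys Xs Ys)).symm)

end MSO₂

/-! ## Paths -/

namespace LDAG

variable {T : Type u} {H : LDAG T}

theorem adj_src_tgt (e : H.E) : H.Adj (H.src e) (H.tgt e) := ⟨e, rfl, rfl⟩

theorem adjOn_univ : H.AdjOn Set.univ = H.Adj := by
  ext a b
  simp [AdjOn, Adj]

theorem adjOn_mono {F F' : Set H.E} (hF : F ⊆ F') : H.AdjOn F ≤ H.AdjOn F' :=
  fun _ _ ⟨e, he, h⟩ => ⟨e, hF he, h⟩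

theorem adjOn_le_adj (F : Set H.E) : H.AdjOn F ≤ H.Adj :=
  fun _ _ ⟨e, _, h⟩ => ⟨e, h⟩

theorem ne_of_transGen {a b : H.V} (h : TransGen H.Adj a b) : a ≠ b := by
  rintro rfl
  exact H.acyclic _ h

theorem wellFounded_adj : WellFounded H.Adj :=
  have := H.finV
  wellFounded_of_forall_not_transGen H.acyclic

theorem wellFounded_swap_adj : WellFounded (Function.swap H.Adj) :=
  have := H.finV
  wellFounded_of_forall_not_transGen fun a h => H.acyclic a (transGen_swap.1 h)

/-- The edges `e` successively join the vertices `v`. In a DAG such a walk is simple. -/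
def IsWalk (H : LDAG T) {k : ℕ} (v : Fin (k + 1) → H.V) (e : Fin k → H.E) : Prop :=
  ∀ i, H.src (e i) = v i.castSucc ∧ H.tgt (e i) = v i.succ

section Walk

variable {k : ℕ} {v : Fin (k + 1) → H.V} {e : Fin k → H.E} {F : Set H.E}

theorem IsWalk.cons (hw : H.IsWalk v e) {e₀ : H.E} (he₀ : H.tgt e₀ = v 0) :
    H.IsWalk (Fin.cons (H.src e₀) v : Fin (k + 1 + 1) → H.V)
      (Fin.cons e₀ e : Fin (k + 1) → H.E) := by
  intro i
  cases i using Fin.cases with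
  | zero => simp [he₀]
  | succ i => simpa [Fin.castSucc_succ] using hw i

theorem IsWalk.transGen (hw : H.IsWalk v e) (hF : ∀ i, e i ∈ F) {i j : Fin (k + 1)}
    (hij : i < j) : TransGen (H.AdjOn F) (v i) (v j) := by
  induction j using Fin.induction with
  | zero => simp at hij
  | succ j ih =>
    have last_step : H.AdjOn F (v j.castSucc) (v j.succ) := ⟨e j, hF j, hw j⟩
    rcases (Fin.le_castSucc_iff.2 hij).eq_or_lt with rfl | h
    · exact .single last_step
    · exact (ih h).tail last_step

theorem IsWalk.injective (hw : H.IsWalk v e) : Function.Injective v := by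
  have ne_of_lt (i j : Fin (k + 1)) (hij : i < j) : v i ≠ v j :=
    H.ne_of_transGen (adjOn_univ ▸ hw.transGen (fun _ => Set.mem_univ _) hij)
  intro i j h
  rcases lt_trichotomy i j with hij | hij | hij
  exacts [(ne_of_lt _ _ hij h).elim, hij, (ne_of_lt _ _ hij h.symm).elim]

theorem exists_isWalk_of_reflTransGen {a b : H.V} (h : ReflTransGen (H.AdjOn F) a b) :
    ∃ (k : ℕ) (v : Fin (k + 1) → H.V) (e : Fin k → H.E),
      H.IsWalk v e ∧ (∀ i, e i ∈ F) ∧ v 0 = a ∧ v (Fin.last k) = b := by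
  induction h using ReflTransGen.head_induction_on with
  | refl => exact ⟨0, fun _ => b, Fin.elim0, fun i => i.elim0, fun i => i.elim0, rfl, rfl⟩
  | head h _ ih =>
    obtain ⟨e₀, he₀, rfl, ht⟩ := h
    obtain ⟨k, v, e, hw, hF, h0, hl⟩ := ih
    refine ⟨k + 1, _, _, hw.cons (ht.trans h0.symm), Fin.cases he₀ hF, rfl, ?_⟩
    rw [← Fin.succ_last, Fin.cons_succ, hl]

end Walk

theorem exists_isPathFromTo_subset_iff (F : Set H.E) (a b : H.V) :
    (∃ X Y, H.IsPathFromTo a b X Y ∧ Y ⊆ F) ↔ ReflTransGen (H.AdjOn F) a b := by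
  constructor
  · rintro ⟨X, Y, ⟨k, v, e, -, hw, rfl, rfl, rfl, rfl⟩, hF⟩
    rcases (Fin.zero_le (Fin.last k)).eq_or_lt with h | h
    · rw [← h]
    · exact (IsWalk.transGen hw (fun i => hF ⟨i, rfl⟩) h).to_reflTransGen
  · intro h
    obtain ⟨k, v, e, hw, hF, h0, hl⟩ := exists_isWalk_of_reflTransGen h
    exact ⟨_, _, ⟨k, v, e, hw.injective, hw, h0, hl, rfl, rfl⟩, Set.range_subset_iff.2 hF⟩

theorem exists_isPathFromTo_and_ne_iff (a b : H.V) :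
    (∃ X Y, H.IsPathFromTo a b X Y ∧ a ≠ b) ↔ TransGen H.Adj a b := by
  have reachable := H.exists_isPathFromTo_subset_iff Set.univ a b
  simp only [Set.subset_univ, and_true, adjOn_univ] at reachable
  simp only [exists_and_right, reachable, reflTransGen_iff_eq_or_transGen]
  exact ⟨fun ⟨h, hne⟩ => h.resolve_left hne.symm, fun h => ⟨.inr h, ne_of_transGen h⟩⟩

/-- The local conditions expressed by the formula `MSO₂.path`. In a DAG they characterise the
paths from `a` to `b`; in a digraph they would also allow additional disjoint cycles. -/
structure PathConditions (H : LDAG T) (a b : H.V) (X : Set H.V) (Y : Set H.E) : Prop where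
  start_mem : a ∈ X
  end_mem : b ∈ X
  src_mem : ∀ e ∈ Y, H.src e ∈ X
  tgt_mem : ∀ e ∈ Y, H.tgt e ∈ X
  src_injOn : Set.InjOn H.src Y
  tgt_injOn : Set.InjOn H.tgt Y
  exists_out : ∀ v ∈ X, v ≠ b → ∃ e ∈ Y, H.src e = v
  exists_in : ∀ v ∈ X, v ≠ a → ∃ e ∈ Y, H.tgt e = v
  tgt_ne : ∀ e ∈ Y, H.tgt e ≠ a
  src_ne : ∀ e ∈ Y, H.src e ≠ b

theorem sat_path_iff_pathConditions {n m p q : ℕ} (xs : Fin n → H.V) (ys : Fin m → H.E)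
    (Xs : Fin p → Set H.V) (Ys : Fin q → Set H.E) (x x' : Fin n) (X : Fin p) (Y : Fin q) :
    (MSO₂.path x x' X Y).Sat H xs ys Xs Ys ↔
      H.PathConditions (xs x) (xs x') (Xs X) (Ys Y) := by
  simp only [MSO₂.path, MSO₂.Sat, MSO₂.sat_allE, MSO₂.sat_allV, MSO₂.sat_imp, MSO₂.sat_eqV,
    MSO₂.sat_eqE, Matrix.cons_val_zero, Matrix.cons_val_one, Matrix.cons_val_succ]
  constructor
  · rintro ⟨⟨start_mem, end_mem⟩, mem, inj, out, inn, ends⟩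
    exact {
      start_mem, end_mem
      src_mem := fun e he => mem e _ ⟨he, .inl rfl⟩
      tgt_mem := fun e he => mem e _ ⟨he, .inr rfl⟩
      src_injOn := fun e he e' he' h => inj e' e _ ⟨⟨he, he'⟩, .inl ⟨h, rfl⟩⟩
      tgt_injOn := fun e he e' he' h => inj e' e _ ⟨⟨he, he'⟩, .inr ⟨h, rfl⟩⟩
      exists_out := fun v hv hb => (out v hv).resolve_left hb
      exists_in := fun v hv hb => (inn v hv).resolve_left hb
      tgt_ne := fun e he h => ends ⟨e, he, .inl h⟩
      src_ne := fun e he h => ends ⟨e, he, .inr h⟩ }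
  · intro h
    refine ⟨⟨h.start_mem, h.end_mem⟩, ?_, ?_,
      fun v hv => or_iff_not_imp_left.2 (h.exists_out v hv),
      fun v hv => or_iff_not_imp_left.2 (h.exists_in v hv), ?_⟩
    · rintro e v ⟨he, rfl | rfl⟩
      exacts [h.src_mem e he, h.tgt_mem e he]
    · rintro e e' v ⟨⟨he, he'⟩, ⟨h1, h2⟩ | ⟨h1, h2⟩⟩
      exacts [h.src_injOn he he' (h1.trans h2.symm), h.tgt_injOn he he' (h1.trans h2.symm)]
    · rintro ⟨e, he, h1 | h1⟩
      exacts [h.tgt_ne e he h1, h.src_ne e he h1]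

variable {a b : H.V} {X : Set H.V} {Y : Set H.E}

theorem IsPathFromTo.pathConditions (h : H.IsPathFromTo a b X Y) :
    H.PathConditions a b X Y := by
  obtain ⟨k, v, e, hv, he, rfl, rfl, rfl, rfl⟩ := h
  refine ⟨⟨_, rfl⟩, ⟨_, rfl⟩, ?_, ?_, ?_, ?_, ?_, ?_, ?_, ?_⟩
  · rintro _ ⟨i, rfl⟩; exact ⟨_, (he i).1.symm⟩
  · rintro _ ⟨i, rfl⟩; exact ⟨_, (he i).2.symm⟩
  · rintro _ ⟨i, rfl⟩ _ ⟨j, rfl⟩ h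
    rw [(he i).1, (he j).1] at h
    rw [Fin.castSucc_injective _ (hv h)]
  · rintro _ ⟨i, rfl⟩ _ ⟨j, rfl⟩ h
    rw [(he i).2, (he j).2] at h
    rw [Fin.succ_injective _ (hv h)]
  · rintro _ ⟨i, rfl⟩ h
    rcases Fin.eq_castSucc_or_eq_last i with ⟨i, rfl⟩ | rfl
    · exact ⟨_, ⟨i, rfl⟩, (he i).1⟩
    · exact (h rfl).elim
  · rintro _ ⟨i, rfl⟩ h
    rcases Fin.eq_zero_or_eq_succ i with rfl | ⟨i, rfl⟩
    · exact (h rfl).elim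
    · exact ⟨_, ⟨i, rfl⟩, (he i).2⟩
  · rintro _ ⟨i, rfl⟩ h
    rw [(he i).2] at h
    exact Fin.succ_ne_zero _ (hv h)
  · rintro _ ⟨i, rfl⟩ h
    rw [(he i).1] at h
    exact (Fin.castSucc_lt_last i).ne (hv h)

namespace PathConditions

theorem reflTransGen (h : H.PathConditions a b X Y) {x : H.V} (hx : x ∈ X) :
    ReflTransGen (H.AdjOn Y) x b := by
  induction x using H.wellFounded_swap_adj.induction with
  | h x ih =>
    by_cases hb : x = b
    · rw [hb]
    · obtain ⟨e, he, rfl⟩ := h.exists_out x hx hb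
      exact .head ⟨e, he, rfl, rfl⟩ (ih _ (adj_src_tgt e) (h.tgt_mem e he))

variable {k : ℕ} {v : Fin (k + 1) → H.V} {e : Fin k → H.E}

theorem mem_range_of_src_mem_range (h : H.PathConditions a b X Y) (hw : H.IsWalk v e)
    (hY : ∀ i, e i ∈ Y) (hl : v (Fin.last k) = b) {e₀ : H.E} (he₀ : e₀ ∈ Y)
    (hsrc : H.src e₀ ∈ Set.range v) : e₀ ∈ Set.range e := by
  obtain ⟨i, hi⟩ := hsrc
  rcases Fin.eq_castSucc_or_eq_last i with ⟨i, rfl⟩ | rfl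
  · exact ⟨i, h.src_injOn (hY i) he₀ ((hw i).1.trans hi)⟩
  · exact (h.src_ne _ he₀ (hi.symm.trans hl)).elim

theorem eq_range_vertices (h : H.PathConditions a b X Y) (hw : H.IsWalk v e)
    (hY : ∀ i, e i ∈ Y) (h0 : v 0 = a) (hl : v (Fin.last k) = b) : X = Set.range v := by
  refine Set.Subset.antisymm (fun x hx => ?_) ?_
  · induction x using H.wellFounded_adj.induction with
    | h x ih =>
      by_cases hxa : x = a
      · exact ⟨0, h0.trans hxa.symm⟩
      · obtain ⟨e₀, he₀, rfl⟩ := h.exists_in x hx hxa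
        obtain ⟨i, rfl⟩ := h.mem_range_of_src_mem_range hw hY hl he₀
          (ih _ (adj_src_tgt e₀) (h.src_mem _ he₀))
        exact ⟨i.succ, (hw i).2.symm⟩
  · rintro _ ⟨i, rfl⟩
    rcases Fin.eq_castSucc_or_eq_last i with ⟨i, rfl⟩ | rfl
    · exact (hw i).1 ▸ h.src_mem _ (hY i)
    · exact hl ▸ h.end_mem

theorem isPathFromTo (h : H.PathConditions a b X Y) : H.IsPathFromTo a b X Y := by
  obtain ⟨k, v, e, hw, hY, h0, hl⟩ := exists_isWalk_of_reflTransGen (h.reflTransGen h.start_mem)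
  have hX := h.eq_range_vertices hw hY h0 hl
  refine ⟨k, v, e, hw.injective, hw, h0, hl, hX, Set.Subset.antisymm ?_ (Set.range_subset_iff.2 hY)⟩
  exact fun e₀ he₀ => h.mem_range_of_src_mem_range hw hY hl he₀ (hX ▸ h.src_mem e₀ he₀)

end PathConditions

theorem sat_path {n m p q : ℕ} (xs : Fin n → H.V) (ys : Fin m → H.E)
    (Xs : Fin p → Set H.V) (Ys : Fin q → Set H.E) (x x' : Fin n) (X : Fin p) (Y : Fin q) :
    (MSO₂.path x x' X Y).Sat H xs ys Xs Ys ↔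
      H.IsPathFromTo (xs x) (xs x') (Xs X) (Ys Y) :=
  (sat_path_iff_pathConditions ..).trans
    ⟨PathConditions.isPathFromTo, IsPathFromTo.pathConditions⟩

theorem sat_gr_lt {n p : ℕ} (xs : Fin n → H.V) (Xs : Fin p → Set H.V) (x y : Fin n) :
    (MSO.lt x y : MSO T n p).gr.Sat H xs ![] Xs ![] ↔ TransGen H.Adj (xs x) (xs y) := by
  simp only [MSO.gr, MSO₂.Sat, sat_path, MSO₂.sat_eqV, Matrix.cons_val_zero]
  exact exists_isPathFromTo_and_ne_iff (xs x) (xs y)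

/-! ## Transitive reduction and coverability -/

theorem transGen_adjOn_compl_of_bypass {e : H.E}
    (he : ReflTransGen (H.AdjOn {e}ᶜ) (H.src e) (H.tgt e)) {u v : H.V}
    (huv : TransGen H.Adj u v) : TransGen (H.AdjOn {e}ᶜ) u v := by
  refine TransGen.closed (fun a b => ?_) _ _ huv
  rintro ⟨e', rfl, rfl⟩
  by_cases h : e' = e
  · subst h
    exact (reflTransGen_iff_eq_or_transGen.1 he).resolve_left
      (ne_of_transGen (.single (adj_src_tgt e'))).symm
  · exact .single ⟨e', h, rfl, rfl⟩

theorem isTransReduced_iff :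
    H.IsTransReduced ↔ ∀ e, ¬ ReflTransGen (H.AdjOn {e}ᶜ) (H.src e) (H.tgt e) := by
  constructor
  · intro h e he
    have all : ({e}ᶜ : Set H.E) = Set.univ := h _ fun u v =>
      ⟨TransGen.mono (adjOn_le_adj _) u v, transGen_adjOn_compl_of_bypass he⟩
    exact (all ▸ Set.mem_univ e : e ∈ ({e}ᶜ : Set H.E)) rfl
  · intro h F hF
    by_contra hne
    obtain ⟨e, he⟩ := (Set.ne_univ_iff_exists_notMem F).1 hne
    have bypass : TransGen (H.AdjOn F) (H.src e) (H.tgt e) :=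
      (hF _ _).2 (.single (adj_src_tgt e))
    exact h e (ReflTransGen.mono (adjOn_mono (Set.subset_compl_singleton_iff.2 he)) _ _
      bypass.to_reflTransGen)

theorem models_rho_iff (H : LDAG T) : H.Models MSO₂.rho ↔ H.IsTransReduced := by
  simp only [LDAG.Models, MSO₂.rho, MSO₂.Sat, sat_path, isTransReduced_iff,
    ← exists_isPathFromTo_subset_iff, Set.subset_compl_singleton_iff, not_exists,
    Matrix.cons_val_zero, Matrix.cons_val_one]
  constructor
  · exact fun h e X Y hXY => h e (H.tgt e) (H.src e) ⟨⟨rfl, rfl⟩, X, Y, hXY⟩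
  · rintro h e _ _ ⟨⟨rfl, rfl⟩, X, Y, hXY⟩
    exact h e X Y hXY

theorem models_gamma_iff (c : ℕ) (H : LDAG T) :
    H.Models (MSO₂.gamma c) ↔ H.CoverableBy c := by
  simp only [LDAG.Models, MSO₂.gamma, MSO₂.sat_exVSs, MSO₂.sat_exESs, MSO₂.Sat, MSO₂.sat_bigAnd,
    sat_path, MSO₂.sat_allV, MSO₂.sat_bigOr, MSO₂.sat_allE, Matrix.cons_val_zero,
    Matrix.cons_val_one, LDAG.CoverableBy, LDAG.IsPath]
  refine exists₂_congr fun X Y => and_congr_left fun _ => forall_congr' fun i => exists_comm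

end LDAG

/-! ## Isomorphisms and Hasse diagrams -/

theorem comp_vecCons {α β : Type*} {n : ℕ} (f : α → β) (a : α) (x : Fin n → α) :
    f ∘ Matrix.vecCons a x = Matrix.vecCons (f a) (f ∘ x) :=
  Fin.comp_cons f a x

namespace LDAG

variable {T : Type u} {H K L : LDAG T}

/-- The inverse of an isomorphism of labelled DAGs. -/
def Iso.symm (f : H.Iso K) : K.Iso H where
  vEquiv := f.vEquiv.symm
  eEquiv := f.eEquiv.symm
  src_eq e := by rw [Equiv.eq_symm_apply, ← f.src_eq, Equiv.apply_symm_apply]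
  tgt_eq e := by rw [Equiv.eq_symm_apply, ← f.tgt_eq, Equiv.apply_symm_apply]
  label_eq v := by rw [← f.label_eq, Equiv.apply_symm_apply]

/-- The composition of isomorphisms of labelled DAGs. -/
def Iso.trans (f : H.Iso K) (g : K.Iso L) : H.Iso L where
  vEquiv := f.vEquiv.trans g.vEquiv
  eEquiv := f.eEquiv.trans g.eEquiv
  src_eq e := by simp [g.src_eq, f.src_eq]
  tgt_eq e := by simp [g.tgt_eq, f.tgt_eq]
  label_eq v := by simp [g.label_eq, f.label_eq]

theorem Iso.sat_iff (f : H.Iso K) {n m p q : ℕ} (φ : MSO₂ T n m p q) (xs : Fin n → H.V)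
    (ys : Fin m → H.E) (Xs : Fin p → Set H.V) (Ys : Fin q → Set H.E) :
    φ.Sat H xs ys Xs Ys ↔ φ.Sat K (f.vEquiv ∘ xs) (f.eEquiv ∘ ys) ((f.vEquiv '' ·) ∘ Xs)
      ((f.eEquiv '' ·) ∘ Ys) := by
  induction φ with
  | memV x X => simp [MSO₂.Sat]
  | memE y Y => simp [MSO₂.Sat]
  | src y x => simp [MSO₂.Sat, f.src_eq]
  | tgt y x => simp [MSO₂.Sat, f.tgt_eq]
  | lab x a => simp [MSO₂.Sat, f.label_eq]
  | and φ ψ ih₁ ih₂ => simp only [MSO₂.Sat, ih₁, ih₂]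
  | or φ ψ ih₁ ih₂ => simp only [MSO₂.Sat, ih₁, ih₂]
  | not φ ih => simp only [MSO₂.Sat, ih]
  | exV φ ih =>
    simp only [MSO₂.Sat, ih, comp_vecCons]
    rw [f.vEquiv.surjective.exists]
  | exE φ ih =>
    simp only [MSO₂.Sat, ih, comp_vecCons]
    rw [f.eEquiv.surjective.exists]
  | exVS φ ih =>
    simp only [MSO₂.Sat, ih, comp_vecCons]
    rw [f.vEquiv.surjective.image_surjective.exists]
  | exES φ ih =>
    simp only [MSO₂.Sat, ih, comp_vecCons]
    rw [f.eEquiv.surjective.image_surjective.exists]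

theorem Iso.models_iff (f : H.Iso K) (φ : MSO₂Sentence T) : H.Models φ ↔ K.Models φ := by
  rw [LDAG.Models, f.sat_iff, LDAG.Models]
  simp only [Matrix.empty_eq]

theorem Iso.adj (f : H.Iso K) : ∀ a b, H.Adj a b → K.Adj (f.vEquiv a) (f.vEquiv b) := by
  rintro _ _ ⟨e, rfl, rfl⟩
  exact ⟨f.eEquiv e, f.src_eq e, f.tgt_eq e⟩

theorem Iso.transGen_adj_iff (f : H.Iso K) {a b : H.V} :
    TransGen K.Adj (f.vEquiv a) (f.vEquiv b) ↔ TransGen H.Adj a b := by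
  refine ⟨fun h => ?_, TransGen.lift (p := K.Adj) f.vEquiv f.adj a b⟩
  simpa [Iso.symm, Function.onFun] using
    TransGen.lift (p := H.Adj) f.symm.vEquiv f.symm.adj _ _ h

theorem Iso.tc_isIso (f : H.Iso K) : H.tc.IsIso K.tc :=
  ⟨⟨f.vEquiv, f.transGen_adj_iff⟩, f.label_eq⟩

theorem transGen_adjOn_compl_or {a b : H.V} (e : H.E) (h : TransGen H.Adj a b) :
    TransGen (H.AdjOn {e}ᶜ) a b ∨
      ReflTransGen H.Adj a (H.src e) ∧ ReflTransGen H.Adj (H.tgt e) b := by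
  induction h with
  | single h =>
    obtain ⟨e', rfl, rfl⟩ := h
    by_cases he : e' = e
    · exact .inr (he ▸ ⟨.refl, .refl⟩)
    · exact .inl (.single ⟨e', he, rfl, rfl⟩)
  | tail hab h ih =>
    obtain ⟨e', rfl, rfl⟩ := h
    rcases ih with ih | ⟨hsrc, htgt⟩
    · by_cases he : e' = e
      · exact .inr (he ▸ ⟨hab.to_reflTransGen, .refl⟩)
      · exact .inl (ih.tail ⟨e', he, rfl, rfl⟩)
    · exact .inr ⟨hsrc, htgt.tail (adj_src_tgt e')⟩

theorem IsTransReduced.covers (h : H.IsTransReduced) (e : H.E) :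
    H.tc.Covers (H.src e) (H.tgt e) := by
  refine ⟨.single (adj_src_tgt e), ?_⟩
  rintro ⟨w, hsw, hwt⟩
  -- In a DAG, neither half of a detour from `src e` to `tgt e` through `w` can use `e` itself.
  have left_avoids : TransGen (H.AdjOn {e}ᶜ) (H.src e) w :=
    (transGen_adjOn_compl_or e hsw).resolve_right fun ⟨_, htw⟩ => H.acyclic _ (hwt.trans_left htw)
  have right_avoids : TransGen (H.AdjOn {e}ᶜ) w (H.tgt e) :=
    (transGen_adjOn_compl_or e hwt).resolve_right fun ⟨hws, _⟩ => H.acyclic _ (hsw.trans_left hws)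
  exact isTransReduced_iff.1 h e (left_avoids.trans right_avoids).to_reflTransGen

theorem IsTransReduced.eq_of_src_eq_of_tgt_eq (h : H.IsTransReduced) {e e' : H.E}
    (hsrc : H.src e = H.src e') (htgt : H.tgt e = H.tgt e') : e = e' := by
  by_contra hne
  exact isTransReduced_iff.1 h e (.single ⟨e', Ne.symm hne, hsrc.symm, htgt.symm⟩)

theorem exists_edge_of_tc_covers {u v : H.V} (h : H.tc.Covers u v) :
    ∃ e, H.src e = u ∧ H.tgt e = v := by
  obtain ⟨w, huw, hwv⟩ := TransGen.tail'_iff.1 h.1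
  rcases reflTransGen_iff_eq_or_transGen.1 huw with rfl | huw
  · exact hwv
  · exact (h.2 ⟨w, huw, .single hwv⟩).elim

theorem IsTransReduced.iso_hasse_tc (h : H.IsTransReduced) : Nonempty (H.Iso H.tc.hasse) :=
  ⟨{  vEquiv := Equiv.refl _
      eEquiv := Equiv.ofBijective (fun e => ⟨(H.src e, H.tgt e), h.covers e⟩) <| by
        refine ⟨fun e e' he => ?_, fun ⟨⟨u, v⟩, huv⟩ => ?_⟩
        · obtain ⟨hsrc, htgt⟩ := Prod.ext_iff.1 (Subtype.ext_iff.1 he)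
          exact h.eq_of_src_eq_of_tgt_eq hsrc htgt
        · obtain ⟨e, rfl, rfl⟩ := exists_edge_of_tc_covers huv
          exact ⟨e, rfl⟩
      src_eq := fun _ => rfl
      tgt_eq := fun _ => rfl
      label_eq := fun _ => rfl }⟩

end LDAG

namespace LPO

variable {T : Type u} {ℓ ℓ' : LPO T}

theorem hasse_adj_iff {u v : ℓ.V} : ℓ.hasse.Adj u v ↔ ℓ.Covers u v :=
  ⟨fun ⟨e, hu, hv⟩ => hu ▸ hv ▸ e.2, fun h => ⟨⟨(u, v), h⟩, rfl, rfl⟩⟩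

theorem transGen_hasse_adj_iff {u v : ℓ.V} : TransGen ℓ.hasse.Adj u v ↔ ℓ.lt u v := by
  classical
  have := ℓ.strict
  have := ℓ.finV
  have := Fintype.ofFinite ℓ.V
  let : PartialOrder ℓ.V := partialOrderOfSO ℓ.lt
  let : LocallyFiniteOrder ℓ.V := Fintype.toLocallyFiniteOrder
  have covers_iff_covBy (a b : ℓ.V) : ℓ.Covers a b ↔ a ⋖ b := by
    simp only [Covers, CovBy, not_exists, not_and]
    rfl
  have adj_eq : ((· ⋖ ·) : ℓ.V → ℓ.V → Prop) = ℓ.hasse.Adj :=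
    funext₂ fun a b => propext ((covers_iff_covBy a b).symm.trans hasse_adj_iff.symm)
  exact (adj_eq ▸ lt_iff_transGen_covBy (x := u) (y := v)).symm

theorem sat_iff_hasse_sat {n p : ℕ} (φ : MSO T n p) (xs : Fin n → ℓ.V) (Xs : Fin p → Set ℓ.V) :
    φ.Sat ℓ xs Xs ↔ φ.gr.Sat ℓ.hasse xs ![] Xs ![] := by
  induction φ with
  | mem x X => rfl
  | lt x y =>
    exact transGen_hasse_adj_iff.symm.trans (LDAG.sat_gr_lt (H := ℓ.hasse) xs Xs x y).symm
  | lab x a => rfl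
  | and φ ψ ih₁ ih₂ => simp only [MSO.Sat, MSO₂.Sat, MSO.gr, ih₁, ih₂]
  | or φ ψ ih₁ ih₂ => simp only [MSO.Sat, MSO₂.Sat, MSO.gr, ih₁, ih₂]
  | not φ ih => simp only [MSO.Sat, MSO₂.Sat, MSO.gr, ih]
  | exV φ ih => exact exists_congr fun v => ih _ _
  | exVS φ ih => exact exists_congr fun A => ih _ _

theorem models_iff_hasse_models (ℓ : LPO T) (φ : MSOSentence T) :
    ℓ.Models φ ↔ ℓ.hasse.Models φ.gr :=
  sat_iff_hasse_sat φ _ _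

theorem hasse_isTransReduced (ℓ : LPO T) : ℓ.hasse.IsTransReduced := by
  rw [LDAG.isTransReduced_iff]
  intro e h
  rcases ReflTransGen.cases_head h with heq | ⟨w, ⟨e', he', hsrc, rfl⟩, hw⟩
  · exact LDAG.ne_of_transGen (.single (LDAG.adj_src_tgt e)) heq
  · have first_step : ℓ.lt (ℓ.hasse.src e) (ℓ.hasse.tgt e') :=
      transGen_hasse_adj_iff.1 (.single ⟨e', hsrc, rfl⟩)
    rcases reflTransGen_iff_eq_or_transGen.1 hw with htgt | hw
    · exact he' (Subtype.ext (Prod.ext hsrc htgt.symm))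
    · exact e.2.2 ⟨_, first_step,
        transGen_hasse_adj_iff.1 (TransGen.mono (LDAG.adjOn_le_adj _) _ _ hw)⟩

theorem hasse_tc_isIso (ℓ : LPO T) : ℓ.hasse.tc.IsIso ℓ :=
  ⟨⟨Equiv.refl _, transGen_hasse_adj_iff.symm⟩, fun _ => rfl⟩

theorem IsIso.trans {ℓ'' : LPO T} : ℓ.IsIso ℓ' → ℓ'.IsIso ℓ'' → ℓ.IsIso ℓ''
  | ⟨f, hf⟩, ⟨g, hg⟩ => ⟨f.trans g, fun v => (hg (f v)).trans (hf v)⟩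

theorem covers_map_iff (f : ℓ.lt ≃r ℓ'.lt) (u v : ℓ.V) :
    ℓ'.Covers (f u) (f v) ↔ ℓ.Covers u v := by
  simp only [Covers, f.map_rel_iff, f.surjective.exists]

theorem IsIso.hasse_iso (h : ℓ.IsIso ℓ') : Nonempty (ℓ.hasse.Iso ℓ'.hasse) := by
  obtain ⟨f, hf⟩ := h
  exact ⟨{
    vEquiv := f.toEquiv
    eEquiv := (f.toEquiv.prodCongr f.toEquiv).subtypeEquiv
      fun p => (covers_map_iff f p.1 p.2).symm
    src_eq := fun _ => rfl
    tgt_eq := fun _ => rfl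
    label_eq := hf }⟩

end LPO

/-! ## Layouts of composed slices -/

section Layout

variable {T : Type u}

/-- The slices of `U` can be composed, the first one has `m` in-frontier vertices, and the last one
has no out-frontier vertices. The empty sequence has no in-frontier vertices. -/
def ComposableFrom : ℕ → List (UnitSlice T) → Prop
  | m, [] => m = 0
  | m, S :: U => S.inn = m ∧ ComposableFrom S.out U

theorem composableFrom_iff {m : ℕ} {U : List (UnitSlice T)} :
    ComposableFrom m U ↔ (U.IsChain fun S S' => S.out = S'.inn) ∧ (∀ S ∈ U.head?, S.inn = m) ∧
      (∀ S ∈ U.getLast?, S.out = 0) ∧ (U = [] → m = 0) := by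
  induction U generalizing m with
  | nil => simp [ComposableFrom]
  | cons S U ih =>
    rw [ComposableFrom, ih]
    cases U with
    | nil => simp
    | cons S' U =>
      simp only [List.isChain_cons_cons, List.head?_cons, List.getLast?_cons_cons]
      simp
      tauto

theorem isUnitDecomposition_iff_composableFrom {U : List (UnitSlice T)} :
    IsUnitDecomposition U ↔ ComposableFrom 0 U := by
  rw [composableFrom_iff]
  exact ⟨fun h => ⟨h.chain, h.initial, h.final, fun _ => rfl⟩, fun h => ⟨h.1, h.2.1, h.2.2.1⟩⟩

/-- The position of the center vertex at which the edge through the in-frontier vertex `i` of the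
first slice of `U` ends; the junk value `0` if there is no such vertex. -/
def frontierTarget : List (UnitSlice T) → ℕ → ℕ
  | [], _ => 0
  | S :: U, i => if h : i < S.inn then
      match S.pass ⟨i, h⟩ with
      | some j => frontierTarget U j + 1
      | none => 0
    else 0

theorem frontierTarget_cons_of_pass_eq_some {S : UnitSlice T} (U : List (UnitSlice T))
    {i : Fin S.inn} {j : Fin S.out} (h : S.pass i = some j) :
    frontierTarget (S :: U) i = frontierTarget U j + 1 := by
  simp [frontierTarget, h]

theorem frontierTarget_cons_of_pass_eq_none {S : UnitSlice T} (U : List (UnitSlice T))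
    {i : Fin S.inn} (h : S.pass i = none) : frontierTarget (S :: U) i = 0 := by
  simp [frontierTarget, h]

/-- An edge leads from the center of `S` to the out-frontier vertex `j`. -/
def UnitSlice.Starts (S : UnitSlice T) (j : ℕ) : Prop :=
  ∃ h : j < S.out, S.pass.symm ⟨j, h⟩ = none

/-- The edges of the DAG described by `U`: the pair `(k, j)` stands for the edge which starts at the
center of the `k`-th slice and crosses the `j`-th out-frontier vertex of this slice. -/
abbrev EdgeCode (U : List (UnitSlice T)) : Type :=
  {p : ℕ × ℕ // ∃ S, U[p.1]? = some S ∧ S.Starts p.2}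

/-- The position of the target of the edge coded by `p`. -/
def edgeTarget (U : List (UnitSlice T)) (p : ℕ × ℕ) : ℕ :=
  p.1 + 1 + frontierTarget (U.drop (p.1 + 1)) p.2

theorem edgeTarget_cons_zero (S : UnitSlice T) (U : List (UnitSlice T)) (j : ℕ) :
    edgeTarget (S :: U) (0, j) = frontierTarget U j + 1 := by
  simp [edgeTarget, add_comm]

theorem edgeTarget_cons_succ (S : UnitSlice T) (U : List (UnitSlice T)) (k j : ℕ) :
    edgeTarget (S :: U) (k + 1, j) = edgeTarget U (k, j) + 1 := by
  simp only [edgeTarget, List.drop_succ_cons]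
  omega

namespace EdgeCode

/-- The code of an edge starting at the center of the first slice. -/
def ofHead {S : UnitSlice T} (U : List (UnitSlice T))
    (j : {j : Fin S.out // S.pass.symm j = none}) :
    EdgeCode (S :: U) :=
  ⟨(0, j.1), S, rfl, j.1.2, j.2⟩

/-- The code in `S :: U` of an edge of the DAG described by `U`. -/
def ofTail (S : UnitSlice T) {U : List (UnitSlice T)} (p : EdgeCode U) : EdgeCode (S :: U) :=
  ⟨(p.1.1 + 1, p.1.2), p.2⟩

theorem bijective_elim_ofHead_ofTail (S : UnitSlice T) (U : List (UnitSlice T)) :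
    Function.Bijective (Sum.elim (ofHead (S := S) U) (ofTail S)) := by
  refine ⟨Function.Injective.sumElim (fun j j' h => ?_) (fun p p' h => ?_) (fun j p h => ?_), ?_⟩
  · exact Subtype.ext (Fin.ext (congrArg (·.1.2) h))
  · simpa [ofTail, Subtype.ext_iff, Prod.ext_iff] using h
  · simpa [ofHead, ofTail] using congrArg (·.1.1) h
  · rintro ⟨⟨k | k, j⟩, S', hS', hj⟩
    · obtain rfl : S = S' := by simpa using hS'
      exact ⟨.inl ⟨⟨j, hj.1⟩, hj.2⟩, rfl⟩
    · exact ⟨.inr ⟨(k, j), S', hS', hj⟩, rfl⟩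

end EdgeCode

/-- An identification of the DAG `H` with the DAG described by the unit slices in `U`. -/
structure Layout (H : LDAG T) (U : List (UnitSlice T)) where
  pos : H.V ≃ Fin U.length
  code : H.E ≃ EdgeCode U
  label_pos : ∀ v, U[pos v].label = H.label v
  pos_src : ∀ e, (pos (H.src e) : ℕ) = (code e).1.1
  pos_tgt : ∀ e, (pos (H.tgt e) : ℕ) = edgeTarget U (code e).1

theorem Layout.nonempty_iso {H K : LDAG T} {U : List (UnitSlice T)} (f : Layout H U)
    (g : Layout K U) : Nonempty (H.Iso K) :=
  ⟨{  vEquiv := f.pos.trans g.pos.symm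
      eEquiv := f.code.trans g.code.symm
      src_eq := fun e => g.pos.injective (Fin.ext (by simp [f.pos_src, g.pos_src]))
      tgt_eq := fun e => g.pos.injective (Fin.ext (by simp [f.pos_tgt, g.pos_tgt]))
      label_eq := fun v => by simp [← f.label_pos, ← g.label_pos] }⟩

end Layout

namespace Slice

variable {T : Type u}

/-- The edge starting in the `i`-th in-frontier vertex. -/
noncomputable def inEdge (A : Slice T) (i : Fin A.inn) : A.E := (A.in_unique i).choose

theorem src_inEdge (A : Slice T) (i : Fin A.inn) : A.src (A.inEdge i) = .inl i :=
  (A.in_unique i).choose_spec.1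

theorem eq_inEdge {A : Slice T} {e : A.E} {i : Fin A.inn} (he : A.src e = .inl i) :
    e = A.inEdge i :=
  (A.in_unique i).choose_spec.2 e he

variable (S A : Slice T) (h : S.out = A.inn)

open Classical in
/-- The edge of `S ∘ A` which begins with the edge `e` of `S`. -/
noncomputable def glueLeft (e : S.E) : (S.glue A h).E :=
  if he : (S.tgt e).isLeft then .inl ⟨e, he⟩
  else .inr (.inl ⟨(e, A.inEdge (((S.tgt e).getRight (by simpa using he)).cast h)),
    _, by simp, A.src_inEdge _⟩)

/-- The edge of `S ∘ A` given by an edge of `A` starting at a center vertex. -/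
def glueRight (e : {e : A.E // (A.src e).isRight}) : (S.glue A h).E := .inr (.inr e)

variable {S}

theorem glueLeft_of_tgt_eq_inl {e : S.E} {v : S.C} (hv : S.tgt e = .inl v) :
    S.glueLeft A h e = .inl ⟨e, by simp [hv]⟩ :=
  dif_pos _

theorem glueLeft_of_tgt_eq_inr {e : S.E} {j : Fin S.out} (hj : S.tgt e = .inr j) :
    S.glueLeft A h e = .inr (.inl ⟨(e, A.inEdge (j.cast h)), j, hj, A.src_inEdge _⟩) := by
  simp [glueLeft, hj]
  rfl

theorem src_glueLeft (e : S.E) : (S.glue A h).src (S.glueLeft A h e) = (S.src e).map id .inl := by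
  rcases hv : S.tgt e with v | j
  · rw [glueLeft_of_tgt_eq_inl A h hv]; rfl
  · rw [glueLeft_of_tgt_eq_inr A h hv]; rfl

theorem tgt_glueLeft_of_tgt_eq_inl {e : S.E} {v : S.C} (hv : S.tgt e = .inl v) :
    (S.glue A h).tgt (S.glueLeft A h e) = .inl (.inl v) := by
  rw [glueLeft_of_tgt_eq_inl A h hv]
  simp [glue, hv]

theorem tgt_glueLeft_of_tgt_eq_inr {e : S.E} {j : Fin S.out} (hj : S.tgt e = .inr j) :
    (S.glue A h).tgt (S.glueLeft A h e) = (A.tgt (A.inEdge (j.cast h))).map .inr id := by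
  rw [glueLeft_of_tgt_eq_inr A h hj]
  rfl

theorem glueLeft_injective : Function.Injective (S.glueLeft A h) := by
  intro e e' hee'
  rcases hv : S.tgt e with v | j <;> rcases hv' : S.tgt e' with v' | j'
  · rw [glueLeft_of_tgt_eq_inl A h hv, glueLeft_of_tgt_eq_inl A h hv'] at hee'
    exact congrArg (·.1) (Sum.inl_injective hee')
  · rw [glueLeft_of_tgt_eq_inl A h hv, glueLeft_of_tgt_eq_inr A h hv'] at hee'
    exact absurd hee' Sum.inl_ne_inr
  · rw [glueLeft_of_tgt_eq_inr A h hv, glueLeft_of_tgt_eq_inl A h hv'] at hee'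
    exact absurd hee' Sum.inr_ne_inl
  · rw [glueLeft_of_tgt_eq_inr A h hv, glueLeft_of_tgt_eq_inr A h hv'] at hee'
    exact congrArg (·.1.1) (Sum.inl_injective (Sum.inr_injective hee'))

theorem glueLeft_ne_glueRight (e : S.E) (e' : {e : A.E // (A.src e).isRight}) :
    S.glueLeft A h e ≠ S.glueRight A h e' := by
  rcases hv : S.tgt e with v | j
  · rw [glueLeft_of_tgt_eq_inl A h hv]
    exact Sum.inl_ne_inr
  · rw [glueLeft_of_tgt_eq_inr A h hv]
    exact fun hee' => Sum.inl_ne_inr (Sum.inr_injective hee')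

theorem bijective_elim_glueLeft_glueRight :
    Function.Bijective (Sum.elim (S.glueLeft A h) (S.glueRight A h)) := by
  refine ⟨Function.Injective.sumElim (glueLeft_injective A h) ?_ (glueLeft_ne_glueRight A h), ?_⟩
  · exact Sum.inr_injective.comp Sum.inr_injective
  · rintro (⟨e, he⟩ | ⟨⟨e, e'⟩, j, hj, hj'⟩ | e)
    · obtain ⟨v, hv⟩ := Sum.isLeft_iff.1 he
      exact ⟨.inl e, glueLeft_of_tgt_eq_inl A h hv⟩
    · obtain rfl := eq_inEdge hj'
      exact ⟨.inl e, glueLeft_of_tgt_eq_inr A h hj⟩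
    · exact ⟨.inr e, rfl⟩

end Slice

section SliceLayout

variable {T : Type u} {A : Slice T} {U : List (UnitSlice T)}

/-- An identification of the slice `A` with the slice described by the unit slices in `U`, which
may begin with a slice with nonempty in-frontier. The edges of `A` are those entering through an
in-frontier vertex and those starting at a center vertex. -/
structure SliceLayout (A : Slice T) (U : List (UnitSlice T)) where
  pos : A.C ≃ Fin U.length
  edge : Fin A.inn ⊕ EdgeCode U ≃ A.E
  label_pos : ∀ v, U[pos v].label = A.label v
  src_inl : ∀ i, A.src (edge (.inl i)) = .inl i
  src_inr : ∀ p, ∃ v, A.src (edge (.inr p)) = .inr v ∧ (pos v : ℕ) = p.1.1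
  tgt_inl : ∀ i, ∃ v, A.tgt (edge (.inl i)) = .inl v ∧ (pos v : ℕ) = frontierTarget U i
  tgt_inr : ∀ p, ∃ v, A.tgt (edge (.inr p)) = .inl v ∧ (pos v : ℕ) = edgeTarget U p.1

namespace SliceLayout

theorem edge_inl (f : SliceLayout A U) (i : Fin A.inn) : f.edge (.inl i) = A.inEdge i :=
  Slice.eq_inEdge (f.src_inl i)

theorem tgt_inEdge (f : SliceLayout A U) (i : Fin A.inn) :
    ∃ v, A.tgt (A.inEdge i) = .inl v ∧ (f.pos v : ℕ) = frontierTarget U i :=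
  f.edge_inl i ▸ f.tgt_inl i

theorem src_edge_isRight_iff (f : SliceLayout A U) (x : Fin A.inn ⊕ EdgeCode U) :
    (A.src (f.edge x)).isRight ↔ x.isRight := by
  rcases x with i | p
  · simp [f.src_inl]
  · obtain ⟨v, hv, -⟩ := f.src_inr p
    simp [hv]

theorem bijective_edge_inr (f : SliceLayout A U) : Function.Bijective fun p : EdgeCode U =>
    (⟨f.edge (.inr p), (f.src_edge_isRight_iff _).2 rfl⟩ : {e : A.E // (A.src e).isRight}) := by
  refine ⟨fun p p' h => by simpa using h, fun ⟨e, he⟩ => ?_⟩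
  obtain ⟨i | p, rfl⟩ := f.edge.surjective e
  · simp [f.src_inl] at he
  · exact ⟨p, rfl⟩

theorem nonempty_layout (f : SliceLayout A U) (h : A.inn = 0) : Nonempty (Layout A.toLDAG U) := by
  choose s hs hspos using f.src_inr
  choose t ht htpos using f.tgt_inr
  let edge (p : EdgeCode U) : A.toLDAG.E := ⟨(f.edge (.inr p), s p, t p), hs p, ht p⟩
  have edge_bijective : Function.Bijective edge := by
    refine ⟨fun p p' hp => Sum.inr_injective (f.edge.injective (congrArg (·.1.1) hp)), ?_⟩
    rintro ⟨⟨e, v, w⟩, hv, hw⟩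
    obtain ⟨i | p, rfl⟩ := f.edge.surjective e
    · exact (h ▸ i).elim0
    · obtain rfl : s p = v := Sum.inr_injective ((hs p).symm.trans hv)
      obtain rfl : t p = w := Sum.inl_injective ((ht p).symm.trans hw)
      exact ⟨p, rfl⟩
  let code := Equiv.ofBijective edge edge_bijective
  exact ⟨{
    pos := f.pos
    code := code.symm
    label_pos := f.label_pos
    pos_src := code.surjective.forall.2 fun p => by rw [code.symm_apply_apply]; exact hspos p
    pos_tgt := code.surjective.forall.2 fun p => by rw [code.symm_apply_apply]; exact htpos p }⟩

theorem nonempty_empty : Nonempty (SliceLayout (Slice.empty (T := T)) []) := by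
  have : IsEmpty (EdgeCode ([] : List (UnitSlice T))) := ⟨fun p => by simpa using p.2⟩
  exact ⟨{
    pos := Equiv.equivOfIsEmpty Empty (Fin 0)
    edge := Equiv.equivOfIsEmpty (Fin 0 ⊕ _) Empty
    label_pos := fun v => v.elim
    src_inl := fun i => i.elim0
    src_inr := isEmptyElim
    tgt_inl := fun i => i.elim0
    tgt_inr := isEmptyElim }⟩

variable (f : SliceLayout A U) (S : UnitSlice T) (h : S.toSlice.out = A.inn)

/-- The edges of `S ∘ A`, enumerated by those of `S` and the edges of `A` starting at a center
vertex. -/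
noncomputable def glueEdge : Fin S.inn ⊕ EdgeCode (S :: U) ≃ (S.toSlice.glue A h).E :=
  ((Equiv.refl _).sumCongr (.symm (.ofBijective _ (EdgeCode.bijective_elim_ofHead_ofTail S U))))
    |>.trans (Equiv.sumAssoc _ _ _).symm
    |>.trans ((Equiv.refl _).sumCongr (.ofBijective _ f.bijective_edge_inr))
    |>.trans (.ofBijective _ (Slice.bijective_elim_glueLeft_glueRight (S := S.toSlice) A h))

theorem glueEdge_inl (i : Fin S.inn) :
    f.glueEdge S h (.inl i) = S.toSlice.glueLeft A h (.inl i) := rfl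

theorem glueEdge_ofHead (j : {j : Fin S.out // S.pass.symm j = none}) :
    f.glueEdge S h (.inr (.ofHead U j)) = S.toSlice.glueLeft A h (.inr j) := by
  have : (Equiv.ofBijective _ (EdgeCode.bijective_elim_ofHead_ofTail S U)).symm (.ofHead U j) =
      .inl j := by
    rw [Equiv.symm_apply_eq]; rfl
  simp [glueEdge, this]
  rfl

theorem glueEdge_ofTail (p : EdgeCode U) : f.glueEdge S h (.inr (.ofTail S p)) =
    S.toSlice.glueRight A h ⟨f.edge (.inr p), (f.src_edge_isRight_iff _).2 rfl⟩ := by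
  have : (Equiv.ofBijective _ (EdgeCode.bijective_elim_ofHead_ofTail S U)).symm (.ofTail S p) =
      .inr p := by
    rw [Equiv.symm_apply_eq]; rfl
  simp [glueEdge, this]
  rfl

/-- The positions of the center vertices of `S ∘ A`: the center of `S` comes first. -/
def gluePos : (S.toSlice.glue A h).C ≃ Fin (S :: U).length :=
  (Equiv.sumCongr (.refl Unit) f.pos).trans <| (Equiv.sumComm _ _).trans <|
    (Equiv.optionEquivSumPUnit _).symm.trans (finSuccEquiv _).symm

theorem gluePos_inr (v : A.C) : (f.gluePos S h (.inr v) : ℕ) = f.pos v + 1 := rfl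

theorem exists_tgt_glueEdge_inl (i : Fin S.inn) :
    ∃ v, (S.toSlice.glue A h).tgt (f.glueEdge S h (.inl i)) = .inl v ∧
      (f.gluePos S h v : ℕ) = frontierTarget (S :: U) i := by
  rcases hi : S.pass i with - | j
  · have hv : S.toSlice.tgt (.inl i) = .inl () := by simp [UnitSlice.toSlice, hi]
    exact ⟨.inl (), Slice.tgt_glueLeft_of_tgt_eq_inl A h hv,
      (frontierTarget_cons_of_pass_eq_none U hi).symm⟩
  · have hj : S.toSlice.tgt (.inl i) = .inr j := by simp [UnitSlice.toSlice, hi]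
    obtain ⟨v, hv, hpos⟩ := f.tgt_inEdge (j.cast h)
    refine ⟨.inr v, ?_, ?_⟩
    · rw [glueEdge_inl, Slice.tgt_glueLeft_of_tgt_eq_inr A h hj]
      exact congrArg (Sum.map _ id) hv
    · rw [gluePos_inr, hpos]
      exact (frontierTarget_cons_of_pass_eq_some U hi).symm

theorem exists_tgt_glueEdge_ofHead (j : {j : Fin S.out // S.pass.symm j = none}) :
    ∃ v, (S.toSlice.glue A h).tgt (f.glueEdge S h (.inr (.ofHead U j))) = .inl v ∧
      (f.gluePos S h v : ℕ) = edgeTarget (S :: U) (0, j) := by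
  obtain ⟨v, hv, hpos⟩ := f.tgt_inEdge (j.1.cast h)
  refine ⟨.inr v, ?_, ?_⟩
  · rw [glueEdge_ofHead, Slice.tgt_glueLeft_of_tgt_eq_inr (S := S.toSlice) (e := .inr j) A h rfl]
    exact congrArg (Sum.map _ id) hv
  · rw [gluePos_inr, hpos, edgeTarget_cons_zero]
    rfl

theorem exists_tgt_glueEdge_ofTail (p : EdgeCode U) :
    ∃ v, (S.toSlice.glue A h).tgt (f.glueEdge S h (.inr (.ofTail S p))) = .inl v ∧
      (f.gluePos S h v : ℕ) = edgeTarget (S :: U) (p.1.1 + 1, p.1.2) := by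
  obtain ⟨v, hv, hpos⟩ := f.tgt_inr p
  refine ⟨.inr v, ?_, ?_⟩
  · rw [glueEdge_ofTail]
    exact congrArg (Sum.map _ id) hv
  · rw [gluePos_inr, hpos, edgeTarget_cons_succ]

theorem exists_src_glueEdge_ofTail (p : EdgeCode U) :
    ∃ v, (S.toSlice.glue A h).src (f.glueEdge S h (.inr (.ofTail S p))) = .inr v ∧
      (f.gluePos S h v : ℕ) = p.1.1 + 1 := by
  obtain ⟨v, hv, hpos⟩ := f.src_inr p
  refine ⟨.inr v, ?_, ?_⟩
  · rw [glueEdge_ofTail]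
    simp [Slice.glueRight, Slice.glue, hv]
  · rw [gluePos_inr, hpos]

/-- The layout of `S ∘ A` obtained by putting the unit slice `S` in front of the slices in `U`. -/
noncomputable def glue : SliceLayout (S.toSlice.glue A h) (S :: U) where
  pos := f.gluePos S h
  edge := f.glueEdge S h
  label_pos := by
    rintro (v | v)
    · rfl
    · exact f.label_pos v
  src_inl i := Slice.src_glueLeft (S := S.toSlice) A h _
  src_inr := (EdgeCode.bijective_elim_ofHead_ofTail S U).surjective.forall.2 <| by
    rintro (j | p)
    · exact ⟨.inl (), (congrArg _ (f.glueEdge_ofHead S h j)).trans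
        (Slice.src_glueLeft (S := S.toSlice) A h _), rfl⟩
    · exact f.exists_src_glueEdge_ofTail S h p
  tgt_inl := f.exists_tgt_glueEdge_inl S h
  tgt_inr := (EdgeCode.bijective_elim_ofHead_ofTail S U).surjective.forall.2 <| by
    rintro (j | p)
    · exact f.exists_tgt_glueEdge_ofHead S h j
    · exact f.exists_tgt_glueEdge_ofTail S h p

end SliceLayout

theorem ComposableFrom.composedSlice_inn_and_nonempty_sliceLayout {m : ℕ}
    (hU : ComposableFrom m U) :
    (composedSlice U).inn = m ∧ Nonempty (SliceLayout (composedSlice U) U) := by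
  induction U generalizing m with
  | nil => exact ⟨hU.symm, SliceLayout.nonempty_empty⟩
  | cons S U ih =>
    obtain ⟨hinn, ⟨f⟩⟩ := ih hU.2
    rw [composedSlice, dif_pos hinn.symm]
    exact ⟨hU.1, ⟨f.glue S hinn.symm⟩⟩

theorem IsUnitDecomposition.nonempty_layout (hU : IsUnitDecomposition U) :
    Nonempty (Layout (composed U) U) :=
  have ⟨hinn, ⟨f⟩⟩ := (isUnitDecomposition_iff_composableFrom.1
    hU).composedSlice_inn_and_nonempty_sliceLayout
  f.nonempty_layout hinn

end SliceLayout

/-! ## The width of a unit decomposition -/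

namespace LDAG

variable {T : Type u} {H : LDAG T} {pos : H.V → ℕ}

theorem pos_lt_pos_of_transGen (hpos : ∀ e, pos (H.src e) < pos (H.tgt e)) {u v : H.V}
    (h : TransGen H.Adj u v) : pos u < pos v := by
  induction h with
  | single h => obtain ⟨e, rfl, rfl⟩ := h; exact hpos e
  | tail _ h ih => obtain ⟨e, rfl, rfl⟩ := h; exact ih.trans (hpos e)

theorem IsWalk.pos_tgt_le_pos_src (hpos : ∀ e, pos (H.src e) < pos (H.tgt e)) {k : ℕ}
    {v : Fin (k + 1) → H.V} {e : Fin k → H.E} (hw : H.IsWalk v e) {i j : Fin k} (hij : i < j) :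
    pos (H.tgt (e i)) ≤ pos (H.src (e j)) := by
  rw [(hw i).2, (hw j).1]
  rcases (show i.succ ≤ j.castSucc from hij).eq_or_lt with h | h
  · rw [h]
  · exact (pos_lt_pos_of_transGen hpos
      (adjOn_univ ▸ hw.transGen (fun _ => Set.mem_univ _) h)).le

/-- The edges leading from the vertices at positions less than `k` to the other ones. -/
def cut (H : LDAG T) (pos : H.V → ℕ) (k : ℕ) : Set H.E :=
  {e | pos (H.src e) < k ∧ k ≤ pos (H.tgt e)}

theorem IsPath.subsingleton_inter_cut (hpos : ∀ e, pos (H.src e) < pos (H.tgt e)) {X : Set H.V}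
    {Y : Set H.E} (hY : H.IsPath X Y) (k : ℕ) : (Y ∩ H.cut pos k).Subsingleton := by
  obtain ⟨_, _, m, v, ε, -, hw, -, -, -, rfl⟩ := hY
  rintro _ ⟨⟨i, rfl⟩, hi_src, hi_tgt⟩ _ ⟨⟨j, rfl⟩, hj_src, hj_tgt⟩
  rcases lt_trichotomy i j with hij | rfl | hij
  · have := IsWalk.pos_tgt_le_pos_src hpos hw hij
    omega
  · rfl
  · have := IsWalk.pos_tgt_le_pos_src hpos hw hij
    omega

theorem CoverableBy.card_cut_le {c : ℕ} (hH : H.CoverableBy c)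
    (hpos : ∀ e, pos (H.src e) < pos (H.tgt e)) (k : ℕ) : Nat.card (H.cut pos k) ≤ c := by
  obtain ⟨X, Y, hXY, -, hY⟩ := hH
  choose path mem_path using hY
  have injective_path : Function.Injective fun e : H.cut pos k => path e := by
    intro e e' (h : path e = path e')
    exact Subtype.ext ((hXY _).subsingleton_inter_cut hpos k ⟨mem_path e, e.2⟩
      ⟨h ▸ mem_path e', e'.2⟩)
  simpa using Nat.card_le_card_of_injective _ injective_path

end LDAG

section Crosses

variable {T : Type u} {U : List (UnitSlice T)} {p : ℕ × ℕ}

/-- The edge of the DAG described by `U` with code `p` crosses the in-frontier vertex `i` of the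
`k`-th slice. -/
inductive Crosses (U : List (UnitSlice T)) (p : ℕ × ℕ) : ℕ → ℕ → Prop
  | start : Crosses U p (p.1 + 1) p.2
  | pass {k : ℕ} {S : UnitSlice T} {i : Fin S.inn} {j : Fin S.out} (h : Crosses U p k i)
      (hS : U[k]? = some S) (hij : S.pass i = some j) : Crosses U p (k + 1) j

theorem Crosses.lt {k i : ℕ} (h : Crosses U p k i) : p.1 < k := by
  induction h with
  | start => exact Nat.lt_succ_self _
  | pass _ _ _ ih => exact ih.trans (Nat.lt_succ_self _)

theorem Crosses.edgeTarget_eq {k i : ℕ} (h : Crosses U p k i) :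
    edgeTarget U p = k + frontierTarget (U.drop k) i := by
  induction h with
  | start => rfl
  | @pass k S _ _ _ hS hij ih =>
    obtain ⟨hk, rfl⟩ := List.getElem?_eq_some_iff.1 hS
    rw [ih, List.drop_eq_getElem_cons hk, frontierTarget_cons_of_pass_eq_some _ hij]
    omega

theorem Crosses.unique {k i i' : ℕ} (h : Crosses U p k i) (h' : Crosses U p k i') : i = i' := by
  induction h generalizing i' with
  | start =>
    generalize hk : p.1 + 1 = k at h'
    cases h' with
    | start => rfl
    | pass h' => exact absurd h'.lt (by omega)
  | @pass k S i j h hS hij ih =>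
    generalize hk : k + 1 = k' at h'
    cases h' with
    | start => exact absurd h.lt (by omega)
    | @pass k' S' i₁ j' h' hS' hij' =>
      obtain rfl : k = k' := by omega
      obtain rfl : S = S' := Option.some_injective _ (hS.symm.trans hS')
      obtain rfl : i = i₁ := Fin.ext (ih h')
      exact congrArg Fin.val (Option.some_injective _ (hij.symm.trans hij'))

theorem IsUnitDecomposition.exists_crosses (hU : IsUnitDecomposition U) {k : ℕ} {S : UnitSlice T}
    (hS : U[k]? = some S) (i : Fin S.inn) : ∃ p : EdgeCode U, Crosses U p.1 k i := by
  induction k generalizing S with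
  | zero =>
    have := hU.initial S (by rw [List.head?_eq_getElem?, hS]; rfl)
    exact (this ▸ i).elim0
  | succ k ih =>
    obtain ⟨hk, rfl⟩ := List.getElem?_eq_some_iff.1 hS
    have hout : U[k].out = U[k + 1].inn := List.isChain_iff_getElem.1 hU.chain k hk
    have hS' : U[k]? = some U[k] := List.getElem?_eq_getElem _
    rcases hp : U[k].pass.symm (i.cast hout.symm) with - | i'
    · exact ⟨⟨(k, i), U[k], hS', _, hp⟩, .start⟩
    · obtain ⟨p, hpi⟩ := ih hS' i'
      exact ⟨p, hpi.pass hS' ((PEquiv.eq_some_iff _).1 hp)⟩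

theorem Layout.pos_src_lt_pos_tgt {H : LDAG T} (f : Layout H U) (e : H.E) :
    (f.pos (H.src e) : ℕ) < f.pos (H.tgt e) := by
  rw [f.pos_src, f.pos_tgt, edgeTarget]
  omega

theorem Layout.inn_le_card_cut {H : LDAG T} (f : Layout H U) (hU : IsUnitDecomposition U) {k : ℕ}
    {S : UnitSlice T} (hS : U[k]? = some S) :
    S.inn ≤ Nat.card (H.cut (fun v => (f.pos v : ℕ)) k) := by
  choose p hp using hU.exists_crosses hS
  have mem_cut (i : Fin S.inn) : f.code.symm (p i) ∈ H.cut (fun v => (f.pos v : ℕ)) k := by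
    constructor
    · simpa [f.pos_src] using (hp i).lt
    · simp [f.pos_tgt, (hp i).edgeTarget_eq]
  have injective : Function.Injective fun i => (⟨_, mem_cut i⟩ : H.cut _ k) := by
    intro i i' h
    have hpp : p i = p i' := f.code.symm.injective (congrArg Subtype.val h)
    exact Fin.ext ((hp i).unique (hpp ▸ hp i'))
  have := H.finE
  simpa using Nat.card_le_card_of_injective _ injective

theorem IsUnitDecomposition.out_eq_inn_or_eq_zero (hU : IsUnitDecomposition U) {k : ℕ}
    {S : UnitSlice T} (hS : U[k]? = some S) :
    (∃ S', U[k + 1]? = some S' ∧ S.out = S'.inn) ∨ S.out = 0 := by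
  obtain ⟨hk, rfl⟩ := List.getElem?_eq_some_iff.1 hS
  rcases Nat.lt_or_ge (k + 1) U.length with h | h
  · exact .inl ⟨_, List.getElem?_eq_getElem h, List.isChain_iff_getElem.1 hU.chain k h⟩
  · obtain rfl : k = U.length - 1 := by omega
    exact .inr (hU.final _ (by rw [List.getLast?_eq_getElem?, hS]; rfl))

theorem IsUnitDecomposition.mem_sliceAlphabet (hU : IsUnitDecomposition U) {c : ℕ}
    (hc : (composed U).CoverableBy c) {S : UnitSlice T} (hS : S ∈ U) : S ∈ sliceAlphabet c T := by
  obtain ⟨f⟩ := hU.nonempty_layout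
  have inn_le {k : ℕ} {S : UnitSlice T} (hS : U[k]? = some S) : S.inn ≤ c :=
    (f.inn_le_card_cut hU hS).trans (hc.card_cut_le f.pos_src_lt_pos_tgt k)
  obtain ⟨k, hk⟩ := List.getElem?_of_mem hS
  refine max_le (inn_le hk) ?_
  rcases hU.out_eq_inn_or_eq_zero hk with ⟨S', hS', h⟩ | h
  · exact h ▸ inn_le hS'
  · exact h ▸ c.zero_le

end Crosses

/-! ## Existence of unit decompositions -/

section PartialId

variable {α : Type*} (s t : Set α)

open Classical in
/-- The identity on `s ∩ t`, as a partial bijection between `s` and `t`. -/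
noncomputable def partialId : s ≃. t where
  toFun x := if h : (x : α) ∈ t then some ⟨x, h⟩ else none
  invFun x := if h : (x : α) ∈ s then some ⟨x, h⟩ else none
  inv x y := by
    simp only [Option.dite_none_right_eq_some, Option.some.injEq]
    constructor <;> (rintro ⟨-, rfl⟩; exact ⟨Subtype.coe_prop _, rfl⟩)

variable {s t}

theorem partialId_of_mem (x : s) (h : (x : α) ∈ t) : partialId s t x = some ⟨x, h⟩ := dif_pos h

theorem partialId_eq_none_iff (x : s) : partialId s t x = none ↔ (x : α) ∉ t := by
  by_cases h : (x : α) ∈ t <;> simp [partialId, h]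

end PartialId

namespace LDAG

variable {T : Type u} (H : LDAG T)

section Cut

variable (pos : H.V → ℕ) (k k' : ℕ)

/-- A numbering of the edges crossing a cut. -/
noncomputable def cutEquiv : H.cut pos k ≃ Fin (Nat.card (H.cut pos k)) :=
  have := H.finE
  Finite.equivFin _

variable {pos} in
theorem eq_of_cutEquiv_eq {k k' : ℕ} (hk : k = k') {e : H.cut pos k} {e' : H.cut pos k'}
    (h : (H.cutEquiv pos k e : ℕ) = H.cutEquiv pos k' e') : (e : H.E) = e' := by
  subst hk
  exact congrArg Subtype.val ((H.cutEquiv pos k).injective (Fin.ext h))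

/-- The partial bijection between the numberings of two cuts which matches the numbers of an edge
crossing both cuts. -/
noncomputable def cutPass : Fin (Nat.card (H.cut pos k)) ≃. Fin (Nat.card (H.cut pos k')) :=
  (H.cutEquiv pos k).symm.toPEquiv.trans <|
    (partialId _ _).trans (H.cutEquiv pos k').toPEquiv

theorem cutPass_symm : (H.cutPass pos k k').symm = H.cutPass pos k' k := by
  rw [cutPass, PEquiv.symm_trans_rev, PEquiv.symm_trans_rev, PEquiv.trans_assoc]
  rfl

variable {pos k k'}

theorem cutPass_cutEquiv (e : H.cut pos k) : H.cutPass pos k k' (H.cutEquiv pos k e) =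
    (partialId _ _ e).map (H.cutEquiv pos k') := by
  change (partialId _ _ ((H.cutEquiv pos k).symm (H.cutEquiv pos k e))).bind _ = _
  rw [Equiv.symm_apply_apply]
  cases partialId _ _ e <;> rfl

theorem cutPass_of_mem (e : H.cut pos k) (h : (e : H.E) ∈ H.cut pos k') :
    H.cutPass pos k k' (H.cutEquiv pos k e) = some (H.cutEquiv pos k' ⟨e, h⟩) := by
  rw [cutPass_cutEquiv, partialId_of_mem e h, Option.map_some]

theorem cutPass_eq_none_iff (e : H.cut pos k) :
    H.cutPass pos k k' (H.cutEquiv pos k e) = none ↔ (e : H.E) ∉ H.cut pos k' := by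
  rw [cutPass_cutEquiv, Option.map_eq_none_iff, partialId_eq_none_iff]

end Cut

variable {n : ℕ} (pos : H.V ≃ Fin n)

/-- The unit slice around the vertex at position `k`. -/
noncomputable def unitSlice (k : Fin n) : UnitSlice T where
  inn := Nat.card (H.cut (fun v => pos v) k)
  out := Nat.card (H.cut (fun v => pos v) (k + 1))
  label := H.label (pos.symm k)
  pass := H.cutPass _ _ _

/-- The sequence of the unit slices around the vertices of `H`. -/
noncomputable def unitDecomposition : List (UnitSlice T) := List.ofFn (H.unitSlice pos)

theorem length_unitDecomposition : (H.unitDecomposition pos).length = n := List.length_ofFn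

theorem getElem?_unitDecomposition_eq_some_iff {k : ℕ} {S : UnitSlice T} :
    (H.unitDecomposition pos)[k]? = some S ↔ ∃ h : k < n, H.unitSlice pos ⟨k, h⟩ = S := by
  simp [unitDecomposition]

theorem isUnitDecomposition_unitDecomposition :
    IsUnitDecomposition (H.unitDecomposition pos) where
  chain := List.isChain_iff_getElem.2 fun i hi => by simp [unitDecomposition, unitSlice]
  initial S hS := by
    rw [List.head?_eq_getElem?] at hS
    obtain ⟨h, rfl⟩ := (H.getElem?_unitDecomposition_eq_some_iff pos).1 hS
    exact Nat.card_eq_zero.2 (.inl ⟨fun e => Nat.not_lt_zero _ e.2.1⟩)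
  final S hS := by
    rw [List.getLast?_eq_getElem?] at hS
    obtain ⟨h, rfl⟩ := (H.getElem?_unitDecomposition_eq_some_iff pos).1 hS
    refine Nat.card_eq_zero.2 (.inl ⟨fun e => ?_⟩)
    have le_pos := e.2.2
    have pos_lt := (pos (H.tgt e.1)).2
    simp only [length_unitDecomposition] at le_pos h
    omega

variable {pos}

theorem pass_symm_unitSlice_eq_none_iff {k : Fin n} (e : H.cut (fun v => pos v) (k + 1)) :
    (H.unitSlice pos k).pass.symm (H.cutEquiv _ _ e) = none ↔ pos (H.src e) = k := by
  have pos_src_lt : (pos (H.src e) : ℕ) < k + 1 := e.2.1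
  have lt_pos_tgt : (k : ℕ) + 1 ≤ pos (H.tgt e) := e.2.2
  have symm_pass : (H.unitSlice pos k).pass.symm = H.cutPass (fun v => pos v) (k + 1) k :=
    H.cutPass_symm _ _ _
  rw [symm_pass]
  refine (H.cutPass_eq_none_iff e).trans ?_
  simp only [cut, Set.mem_ofPred_eq, Fin.ext_iff]
  omega

theorem starts_unitSlice_iff {k : Fin n} {j : ℕ} : (H.unitSlice pos k).Starts j ↔
    ∃ e : H.cut (fun v => pos v) (k + 1), pos (H.src e) = k ∧ H.cutEquiv _ _ e = j := by
  constructor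
  · rintro ⟨hj, hn⟩
    obtain ⟨e, he⟩ := (H.cutEquiv _ _).surjective ⟨j, hj⟩
    exact ⟨e, (H.pass_symm_unitSlice_eq_none_iff e).1 (he ▸ hn), congrArg Fin.val he⟩
  · rintro ⟨e, he, rfl⟩
    exact ⟨Fin.is_lt _, (H.pass_symm_unitSlice_eq_none_iff e).2 he⟩

variable (pos) in
theorem drop_unitDecomposition (k : Fin n) : (H.unitDecomposition pos).drop k =
    H.unitSlice pos k :: (H.unitDecomposition pos).drop (k + 1) := by
  rw [List.drop_eq_getElem_cons (by simp [H.length_unitDecomposition])]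
  simp [unitDecomposition]

theorem frontierTarget_drop_unitDecomposition {k : ℕ} (e : H.cut (fun v => pos v) k) :
    k + frontierTarget ((H.unitDecomposition pos).drop k) (H.cutEquiv _ _ e) =
      pos (H.tgt e) := by
  obtain ⟨d, hd⟩ : ∃ d, (pos (H.tgt e) : ℕ) = k + d := Nat.exists_eq_add_of_le e.2.2
  have hk : k < n := by have := (pos (H.tgt e)).2; omega
  induction d generalizing k with
  | zero =>
    have hnone : (H.unitSlice pos ⟨k, hk⟩).pass (H.cutEquiv _ k e) = none :=
      (H.cutPass_eq_none_iff e).2 fun h => by have : k + 1 ≤ (pos (H.tgt e) : ℕ) := h.2; omega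
    rw [H.drop_unitDecomposition pos ⟨k, hk⟩, frontierTarget_cons_of_pass_eq_none _ hnone, hd]
  | succ d ih =>
    have hmem : (e : H.E) ∈ H.cut (fun v => pos v) (k + 1) :=
      ⟨e.2.1.trans k.lt_succ_self, by dsimp only; omega⟩
    have hsome : (H.unitSlice pos ⟨k, hk⟩).pass (H.cutEquiv _ k e) =
        some (H.cutEquiv _ (k + 1) ⟨e, hmem⟩) := H.cutPass_of_mem e hmem
    have := ih ⟨e, hmem⟩ (by dsimp only; omega) (by omega)
    rw [H.drop_unitDecomposition pos ⟨k, hk⟩, frontierTarget_cons_of_pass_eq_some _ hsome]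
    dsimp only at this ⊢
    omega

variable (hpos : ∀ e, pos (H.src e) < pos (H.tgt e))

/-- The code of an edge of `H` in the unit decomposition along `pos`. -/
noncomputable def edgeCode (e : H.E) : EdgeCode (H.unitDecomposition pos) :=
  let e' : H.cut (fun v => pos v) (pos (H.src e) + 1) := ⟨e, Nat.lt_succ_self _, hpos e⟩
  ⟨(pos (H.src e), H.cutEquiv _ _ e'), _,
    (H.getElem?_unitDecomposition_eq_some_iff pos).2 ⟨(pos (H.src e)).2, rfl⟩,
    (H.starts_unitSlice_iff).2 ⟨e', rfl, rfl⟩⟩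

theorem bijective_edgeCode : Function.Bijective (H.edgeCode hpos) := by
  constructor
  · intro e e' h
    exact H.eq_of_cutEquiv_eq (congrArg (·.1.1 + 1) h) (congrArg (·.1.2) h)
  · rintro ⟨⟨k, j⟩, S, hS, hj⟩
    obtain ⟨hk, rfl⟩ := (H.getElem?_unitDecomposition_eq_some_iff pos).1 hS
    dsimp only at hk hj
    obtain ⟨⟨e, he⟩, hsrc, rfl⟩ := H.starts_unitSlice_iff.1 hj
    obtain rfl : (pos (H.src e) : ℕ) = k := congrArg Fin.val hsrc
    exact ⟨e, rfl⟩

/-- The layout of `H` along `pos`. -/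
noncomputable def layout : Layout H (H.unitDecomposition pos) where
  pos := pos.trans (finCongr (H.length_unitDecomposition pos).symm)
  code := .ofBijective _ (H.bijective_edgeCode hpos)
  label_pos v := by
    simp only [unitDecomposition, List.getElem_ofFn, Fin.getElem_fin]
    exact congrArg H.label (pos.symm_apply_apply v)
  pos_src e := rfl
  pos_tgt e := (H.frontierTarget_drop_unitDecomposition (pos := pos)
    ⟨e, Nat.lt_succ_self _, hpos e⟩).symm

theorem exists_isUnitDecomposition (H : LDAG T) :
    ∃ U, IsUnitDecomposition U ∧ Nonempty ((composed U).Iso H) := by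
  have := H.finV
  obtain ⟨n, pos, pos_lt_pos⟩ := exists_equivFin_of_forall_not_transGen H.acyclic
  have hpos : ∀ e, pos (H.src e) < pos (H.tgt e) := fun e => pos_lt_pos _ _ ⟨e, rfl, rfl⟩
  have hU := H.isUnitDecomposition_unitDecomposition pos
  obtain ⟨f⟩ := hU.nonempty_layout
  exact ⟨_, hU, f.nonempty_iso (LDAG.layout H hpos)⟩

end LDAG

/-! ## Regular languages -/

section Regular

variable {α β : Type*}

theorem isRegular_of_foldr {L : Language α} {σ : Type} [Finite σ] (δ : α → σ → σ) (s₀ : σ)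
    (F : Set σ) (h : ∀ x, x ∈ L ↔ x.foldr δ s₀ ∈ F) : L.IsRegular := by
  have := Fintype.ofFinite σ
  refine .of_reverse ⟨σ, inferInstance, ⟨fun s a => δ a s, s₀, F⟩, ?_⟩
  ext x
  rw [Language.mem_reverse, h, List.foldr_reverse]
  rfl

theorem isRegular_exists_mem (P : α → Prop) : Language.IsRegular {x | ∃ a ∈ x, P a} :=
  isRegular_of_foldr (fun a s => P a ∨ s) False {s | s} fun x => by
    change (∃ a ∈ x, P a) ↔ x.foldr (fun a s => P a ∨ s) False
    induction x with
    | nil => simp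
    | cons a x ih => simpa using or_congr_right ih

theorem isRegular_forall_mem (P : α → Prop) : Language.IsRegular {x | ∀ a ∈ x, P a} :=
  isRegular_of_foldr (fun a s => P a ∧ s) True {s | s} fun x => by
    change (∀ a ∈ x, P a) ↔ x.foldr (fun a s => P a ∧ s) True
    induction x with
    | nil => simp
    | cons a x ih => simpa using and_congr_right fun _ => ih

theorem existsUnique_fin_succ_iff {n : ℕ} {P : Fin (n + 1) → Prop} :
    (∃! k, P k) ↔ P 0 ∧ (¬ ∃ k : Fin n, P k.succ) ∨ ¬ P 0 ∧ ∃! k : Fin n, P k.succ := by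
  by_cases h : P 0 <;> simp [ExistsUnique, Fin.exists_fin_succ, Fin.forall_fin_succ, h,
    Fin.succ_ne_zero, (Fin.succ_ne_zero _).symm]

theorem existsUnique_getElem_cons_iff (P : α → Prop) (a : α) (x : List α) :
    (∃! k : Fin (a :: x).length, P (a :: x)[k]) ↔
      P a ∧ (¬ ∃ b ∈ x, P b) ∨ ¬ P a ∧ ∃! k : Fin x.length, P x[k] := by
  have := existsUnique_fin_succ_iff (n := x.length) (P := fun k => P (a :: x)[k])
  simpa [List.exists_mem_iff_getElem, Fin.forall_iff] using this

theorem isRegular_existsUnique (P : α → Prop) :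
    Language.IsRegular {x | ∃! k : Fin x.length, P x[k]} :=
  isRegular_of_foldr (fun a s => (P a ∨ s.1, P a ∧ ¬ s.1 ∨ ¬ P a ∧ s.2)) (False, False)
    {s : Prop × Prop | s.2} fun x => by
    suffices h : x.foldr (fun a (s : Prop × Prop) => (P a ∨ s.1, P a ∧ ¬ s.1 ∨ ¬ P a ∧ s.2))
        (False, False) = ((∃ a ∈ x, P a), ∃! k : Fin x.length, P x[k]) from
      iff_of_eq (congrArg Prod.snd h).symm
    induction x with
    | nil => simp
    | cons a x ih =>
      simp only [List.foldr_cons, ih, existsUnique_getElem_cons_iff, List.exists_mem_cons_iff]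

theorem isRegular_forall {ι : Type*} [Finite ι] {L : ι → Language α} (h : ∀ i, (L i).IsRegular) :
    Language.IsRegular {x | ∀ i, x ∈ L i} := by
  have := Fintype.ofFinite ι
  have setOf_forall_eq : {x | ∀ i, x ∈ L i} = Finset.univ.inf L := by
    rw [Finset.inf_univ_eq_iInf]
    exact Set.ext fun x => (Set.mem_iInter (s := L)).symm
  rw [setOf_forall_eq]
  refine Finset.inf_induction ?_ (fun _ h₁ _ h₂ => h₁.inf h₂) fun i _ => h i
  exact isRegular_of_foldr (fun _ => id) () .univ fun _ => iff_of_true trivial trivial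

theorem cons_mem_acceptsFrom_singleton {σ : Type*} (M : NFA α σ) (s : σ) (a : α) (x : List α) :
    a :: x ∈ M.acceptsFrom {s} ↔ ∃ s' ∈ M.step s a, x ∈ M.acceptsFrom {s'} := by
  rw [NFA.cons_mem_acceptsFrom, NFA.stepSet_singleton]
  simp only [NFA.mem_acceptsFrom, NFA.mem_evalFrom_iff_exists (S := M.step s a)]
  aesop

/-- The automaton obtained from `M` by replacing every letter `a` by the letter `f a`. -/
def imageNFA {σ : Type*} (M : DFA α σ) (f : α → β) : NFA β σ where
  step := fun s b => {s' | ∃ a, f a = b ∧ M.step s a = s'}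
  start := {M.start}
  accept := M.accept

theorem mem_acceptsFrom_imageNFA {σ : Type*} {M : DFA α σ} {f : α → β} {s : σ} {y : List β} :
    y ∈ (imageNFA M f).acceptsFrom {s} ↔ ∃ x, x.map f = y ∧ M.evalFrom s x ∈ M.accept := by
  induction y generalizing s with
  | nil => simp [imageNFA]
  | cons b y ih =>
    rw [cons_mem_acceptsFrom_singleton]
    simp only [ih, List.map_eq_cons_iff]
    simp only [imageNFA]
    aesop

theorem isRegular_map {L : Language α} (h : L.IsRegular) (f : α → β) :
    (Language.map f L).IsRegular := by
  obtain ⟨σ, _, M, rfl⟩ := h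
  refine ⟨Set σ, inferInstance, (imageNFA M f).toDFA, ?_⟩
  rw [NFA.toDFA_correct, NFA.accepts_eq_acceptsFrom_start]
  ext y
  exact mem_acceptsFrom_imageNFA.trans (exists_congr fun x => and_comm)

end Regular

/-! ## Marked slices -/

section Mark

variable {α A B : Type*}

/-- The word obtained from `x` by attaching the mark `f k` to its `k`-th letter. -/
def mark (x : List α) (f : Fin x.length → A) : List (α × A) := List.ofFn fun k => (x[k], f k)

theorem exists_mem_mark {x : List α} {f : Fin x.length → A} {P : α × A → Prop} :
    (∃ a ∈ mark x f, P a) ↔ ∃ k, P (x[k], f k) := by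
  simp [mark, List.mem_ofFn]

theorem forall_mem_mark {x : List α} {f : Fin x.length → A} {P : α × A → Prop} :
    (∀ a ∈ mark x f, P a) ↔ ∀ k, P (x[k], f k) :=
  List.forall_mem_ofFn_iff

theorem existsUnique_getElem_mark {x : List α} {f : Fin x.length → A} {P : α × A → Prop} :
    (∃! k : Fin (mark x f).length, P (mark x f)[k]) ↔ ∃! k, P (x[k], f k) :=
  (finCongr List.length_ofFn).existsUnique_congr fun _ =>
    iff_of_eq (congrArg P (List.getElem_ofFn _))

theorem getElem?_mark_eq_some {x : List α} {f : Fin x.length → A} {k : ℕ} {a : α × A} :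
    (mark x f)[k]? = some a ↔ ∃ h : k < x.length, (x[k], f ⟨k, h⟩) = a := by
  simp [mark]

theorem map_fst_mark (x : List α) (f : Fin x.length → A) : (mark x f).map Prod.fst = x := by
  simp [mark, Function.comp_def]

theorem map_mark (x : List α) (f : Fin x.length → A) (g : A → B) :
    (mark x f).map (Prod.map id g) = mark x (g ∘ f) := by
  simp [mark, Function.comp_def]

theorem mark_injective (x : List α) : Function.Injective (mark (A := A) x) := fun _ _ h =>
  funext fun k => congrArg Prod.snd (congrFun (List.ofFn_injective h) k)

theorem exists_mark_map_fst_eq (y : List (α × A)) : ∃ f, mark (y.map Prod.fst) f = y :=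
  ⟨fun k => (y[k]'(by simpa using k.2)).2, List.ext_getElem (by simp [mark]) (by simp [mark])⟩

theorem mark_mem_map_iff {L : Language (α × A)} {g : A → B} {x : List α} {f : Fin x.length → B} :
    mark x f ∈ Language.map (Prod.map id g) L ↔ ∃ f', g ∘ f' = f ∧ mark x f' ∈ L := by
  constructor
  · rintro ⟨y, hy, hyf⟩
    obtain rfl : y.map Prod.fst = x := by
      rw [← map_fst_mark x f, ← hyf]
      simp
    obtain ⟨f', hf'⟩ := exists_mark_map_fst_eq y
    exact ⟨f', mark_injective _ (by rw [← map_mark, hf', hyf]), hf'.symm ▸ hy⟩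
  · rintro ⟨f', rfl, hf'⟩
    exact ⟨_, hf', map_mark x f' g⟩

end Mark

/-- Values of the free variables of an MSO₂ formula: elements of `α`, `β`, `γ` and `δ` for its
vertex, edge, vertex set and edge set variables. -/
@[ext]
structure Assignment (α β γ δ : Type) (n m p q : ℕ) where
  vertex : Fin n → α
  edge : Fin m → β
  vertexSet : Fin p → γ
  edgeSet : Fin q → δ

namespace Assignment

variable {α β γ δ α' β' γ' δ' : Type} {n m p q : ℕ}

/-- The assignment obtained by applying a function to the values of each sort. -/
def map (f : α → α') (g : β → β') (h : γ → γ') (k : δ → δ') (a : Assignment α β γ δ n m p q) :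
    Assignment α' β' γ' δ' n m p q :=
  ⟨f ∘ a.vertex, g ∘ a.edge, h ∘ a.vertexSet, k ∘ a.edgeSet⟩

/-- Forget the value of the vertex variable `0`. -/
def dropVertex (a : Assignment α β γ δ (n + 1) m p q) : Assignment α β γ δ n m p q :=
  ⟨Fin.tail a.vertex, a.edge, a.vertexSet, a.edgeSet⟩

/-- Forget the value of the edge variable `0`. -/
def dropEdge (a : Assignment α β γ δ n (m + 1) p q) : Assignment α β γ δ n m p q :=
  ⟨a.vertex, Fin.tail a.edge, a.vertexSet, a.edgeSet⟩

/-- Forget the value of the vertex set variable `0`. -/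
def dropVertexSet (a : Assignment α β γ δ n m (p + 1) q) : Assignment α β γ δ n m p q :=
  ⟨a.vertex, a.edge, Fin.tail a.vertexSet, a.edgeSet⟩

/-- Forget the value of the edge set variable `0`. -/
def dropEdgeSet (a : Assignment α β γ δ n m p (q + 1)) : Assignment α β γ δ n m p q :=
  ⟨a.vertex, a.edge, a.vertexSet, Fin.tail a.edgeSet⟩

end Assignment

/-- The assignments of an MSO₂ formula with values in `H`. -/
abbrev LDAG.Assignment {T : Type u} (H : LDAG T) (n m p q : ℕ) : Type :=
  _root_.Assignment H.V H.E (Set H.V) (Set H.E) n m p q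

/-- What a unit slice has to remember of an assignment: for each vertex or vertex set variable
whether its center is (in) the value, and for each edge or edge set variable the numbers of the
out-frontier vertices through which the value leaves the center. -/
abbrev Marking (n m p q : ℕ) : Type := Assignment Prop (Set ℕ) Prop (Set ℕ) n m p q

/-- The words of marked slices whose marks describe an assignment. -/
def assignmentMarkings (T : Type u) (n m p q : ℕ) : Language (UnitSlice T × Marking n m p q) :=
  {x | (∀ i, ∃! k : Fin x.length, x[k].2.vertex i) ∧
    (∀ i, ∃! k : Fin x.length, (x[k].2.edge i).Nonempty) ∧
    ∀ s ∈ x, (∀ i, (s.2.edge i).Subsingleton) ∧ (∀ i, ∀ j ∈ s.2.edge i, s.1.Starts j) ∧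
      ∀ i, ∀ j ∈ s.2.edgeSet i, s.1.Starts j}

theorem isRegular_assignmentMarkings (T : Type u) (n m p q : ℕ) :
    (assignmentMarkings T n m p q).IsRegular := by
  let Letter := UnitSlice T × Marking n m p q
  have vertex_regular (i) := isRegular_existsUnique fun s : Letter => s.2.vertex i
  have edge_regular (i) := isRegular_existsUnique fun s : Letter => (s.2.edge i).Nonempty
  exact (isRegular_forall vertex_regular).inf
    ((isRegular_forall edge_regular).inf (isRegular_forall_mem _))

theorem mark_mem_assignmentMarkings {T : Type u} {n m p q : ℕ} {U : List (UnitSlice T)}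
    {g : Fin U.length → Marking n m p q} : mark U g ∈ assignmentMarkings T n m p q ↔
      (∀ i, ∃! k, (g k).vertex i) ∧ (∀ i, ∃! k, ((g k).edge i).Nonempty) ∧
      ∀ k, (∀ i, ((g k).edge i).Subsingleton) ∧ (∀ i, ∀ j ∈ (g k).edge i, U[k].Starts j) ∧
        ∀ i, ∀ j ∈ (g k).edgeSet i, U[k].Starts j :=
  and_congr (forall_congr' fun i =>
    existsUnique_getElem_mark (P := fun s : _ × Marking n m p q => s.2.vertex i)) <|
  and_congr (forall_congr' fun i =>
    existsUnique_getElem_mark (P := fun s : _ × Marking n m p q => (s.2.edge i).Nonempty))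
  forall_mem_mark

theorem EdgeCode.fst_lt {T : Type u} {U : List (UnitSlice T)} (p : EdgeCode U) :
    p.1.1 < U.length :=
  have ⟨_, hS, _⟩ := p.2
  (List.getElem?_eq_some_iff.1 hS).1

namespace Layout

variable {T : Type u} {H : LDAG T} {U : List (UnitSlice T)} (f : Layout H U) {n m p q : ℕ}

/-- The numbers of the out-frontier vertices through which an edge in `Y` leaves the center of the
`k`-th slice. -/
def outEdges (Y : Set H.E) (k : Fin U.length) : Set ℕ := {j | ∃ e ∈ Y, (f.code e).1 = (↑k, j)}

/-- The marking of the slices given by an assignment in `H`. -/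
def marking (a : H.Assignment n m p q) (k : Fin U.length) : Marking n m p q :=
  a.map (fun v => v = f.pos.symm k) (fun e => f.outEdges {e} k) (fun X => f.pos.symm k ∈ X)
    fun Y => f.outEdges Y k

theorem exists_pos_symm_eq_iff {P : Fin U.length → Prop} :
    (∃ v, (fun k => v = f.pos.symm k) = P) ↔ ∃! k, P k := by
  rw [← f.pos.symm.exists_congr_right]
  simp only [funext_iff, eq_iff_iff, ExistsUnique, EmbeddingLike.apply_eq_iff_eq]
  exact exists_congr fun k => ⟨fun h => ⟨(h k).1 rfl, fun k' hk' => ((h k').2 hk').symm⟩,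
    fun h k' => ⟨fun hk => hk ▸ h.1, fun hk => (h.2 k' hk).symm⟩⟩

theorem exists_pos_symm_mem_eq (P : Fin U.length → Prop) :
    ∃ X : Set H.V, (fun k => f.pos.symm k ∈ X) = P :=
  ⟨{v | P (f.pos v)}, by simp⟩

theorem mem_outEdges_code (Y : Set H.E) (e : H.E) :
    (f.code e).1.2 ∈ f.outEdges Y ⟨_, (f.code e).fst_lt⟩ ↔ e ∈ Y := by
  refine ⟨fun ⟨e', he', h⟩ => ?_, fun he => ⟨e, he, rfl⟩⟩
  rwa [f.code.injective (Subtype.ext h)] at he'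

theorem outEdges_injective : Function.Injective f.outEdges := fun Y Y' h => by
  ext e
  rw [← f.mem_outEdges_code, h, f.mem_outEdges_code]

theorem exists_outEdges_eq_iff {J : Fin U.length → Set ℕ} :
    (∃ Y, f.outEdges Y = J) ↔ ∀ k, ∀ j ∈ J k, U[k].Starts j := by
  constructor
  · rintro ⟨Y, rfl⟩ k j ⟨e, -, he⟩
    obtain ⟨S, hS, hj⟩ := (f.code e).2
    rw [he] at hS hj
    rwa [← show U[k] = S by simpa using hS] at hj
  · refine fun hJ => ⟨{e | ∃ k : Fin U.length, ∃ j ∈ J k, (f.code e).1 = (↑k, j)}, ?_⟩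
    ext k j
    constructor
    · rintro ⟨e, ⟨k', j', hj', he'⟩, he⟩
      obtain ⟨hk, rfl⟩ : (k' : ℕ) = k ∧ j' = j := by simpa using he'.symm.trans he
      rwa [← Fin.ext hk]
    · intro hj
      let e : EdgeCode U := ⟨(k, j), U[k], by simp, hJ k j hj⟩
      exact ⟨f.code.symm e, ⟨k, j, hj, by simp [e]⟩, by simp [e]⟩

theorem exists_outEdges_singleton_eq_iff {J : Fin U.length → Set ℕ} :
    (∃ e, f.outEdges {e} = J) ↔ (∃! k, (J k).Nonempty) ∧ (∀ k, (J k).Subsingleton) ∧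
      ∀ k, ∀ j ∈ J k, U[k].Starts j := by
  rw [← f.exists_outEdges_eq_iff]
  constructor
  · rintro ⟨e, rfl⟩
    refine ⟨⟨⟨_, (f.code e).fst_lt⟩, ⟨_, (f.mem_outEdges_code _ _).2 rfl⟩, ?_⟩, ?_, _, rfl⟩
    · rintro k ⟨j, e, rfl, he⟩
      exact Fin.ext (congrArg Prod.fst he).symm
    · rintro k j ⟨e, rfl, he⟩ j' ⟨e, rfl, he'⟩
      exact congrArg Prod.snd (he.symm.trans he')
  · rintro ⟨⟨k, hkne, hk⟩, hJ, Y, rfl⟩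
    obtain ⟨j, e, he, hej⟩ := hkne
    refine ⟨e, congrArg _ (Set.eq_singleton_iff_unique_mem.2 ⟨he, fun e' he' => ?_⟩).symm⟩
    have he'_mem := (f.mem_outEdges_code Y e').2 he'
    obtain rfl := hk _ ⟨_, he'_mem⟩
    exact f.code.injective (Subtype.ext (hej ▸ Prod.ext rfl (hJ _ he'_mem ⟨e, he, hej⟩)))

theorem marking_injective :
    Function.Injective (f.marking (n := n) (m := m) (p := p) (q := q)) := fun a a' h => by
  refine Assignment.ext (funext fun i => ?_) (funext fun i => ?_) (funext fun i => ?_)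
    (funext fun i => ?_)
  · have hpos := congrFun (congrArg Assignment.vertex (congrFun h (f.pos (a.vertex i)))) i
    simpa [marking, Assignment.map, eq_comm] using hpos
  · exact Set.singleton_injective <| f.outEdges_injective <|
      funext fun k => congrFun (congrArg Assignment.edge (congrFun h k)) i
  · ext v
    have hpos := congrFun (congrArg Assignment.vertexSet (congrFun h (f.pos v))) i
    simpa [marking, Assignment.map] using hpos
  · exact f.outEdges_injective <|
      funext fun k => congrFun (congrArg Assignment.edgeSet (congrFun h k)) i

theorem exists_marking_eq_iff {g : Fin U.length → Marking n m p q} :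
    (∃ a, f.marking a = g) ↔ mark U g ∈ assignmentMarkings T n m p q := by
  have exists_marking_eq_iff_forall : (∃ a, f.marking a = g) ↔
      (∀ i, ∃ v, (fun k => v = f.pos.symm k) = fun k => (g k).vertex i) ∧
      (∀ i, ∃ e, f.outEdges {e} = fun k => (g k).edge i) ∧
      (∀ i, ∃ X : Set H.V, (fun k => f.pos.symm k ∈ X) = fun k => (g k).vertexSet i) ∧
      ∀ i, ∃ Y, f.outEdges Y = fun k => (g k).edgeSet i := by
    constructor
    · rintro ⟨a, rfl⟩
      exact ⟨fun i => ⟨_, rfl⟩, fun i => ⟨_, rfl⟩, fun i => ⟨_, rfl⟩, fun i => ⟨_, rfl⟩⟩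
    · rintro ⟨hv, he, hX, hY⟩
      choose v hv using hv
      choose e he using he
      choose X hX using hX
      choose Y hY using hY
      exact ⟨⟨v, e, X, Y⟩, funext fun k => Assignment.ext (funext fun i => congrFun (hv i) k)
        (funext fun i => congrFun (he i) k) (funext fun i => congrFun (hX i) k)
        (funext fun i => congrFun (hY i) k)⟩
  rw [exists_marking_eq_iff_forall, mark_mem_assignmentMarkings]
  simp only [f.exists_pos_symm_eq_iff, f.exists_outEdges_singleton_eq_iff, f.exists_outEdges_eq_iff,
    f.exists_pos_symm_mem_eq, implies_true, true_and]
  simp only [forall_and]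
  exact ⟨fun ⟨hv, ⟨he, hs, hS⟩, hS'⟩ =>
      ⟨hv, he, fun k i => hs i k, fun k i => hS i k, fun k i => hS' i k⟩,
    fun ⟨hv, he, hs, hS, hS'⟩ =>
      ⟨hv, ⟨he, fun i k => hs k i, fun i k => hS k i⟩, fun i k => hS' k i⟩⟩

end Layout

/-! ## Recognizability of MSO₂ formulas -/

section EdgeHits

variable {T : Type u} {A : Type*}

/-- The edge through the in-frontier vertex `i` of the first slice of `w` ends at the center of a
slice satisfying `P`. -/
def FrontierHits (P : UnitSlice T × A → Prop) (w : List (UnitSlice T × A)) (i : ℕ) : Prop :=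
  ∃ a, w[frontierTarget (w.map Prod.fst) i]? = some a ∧ P a

/-- An edge selected by `J` ends at the center of a slice satisfying `P`; here `J` selects edges by
the out-frontier vertex through which they leave the center at which they start. -/
def EdgeHits (P : UnitSlice T × A → Prop) (J : UnitSlice T × A → Set ℕ)
    (w : List (UnitSlice T × A)) : Prop :=
  ∃ k j a b, w[k]? = some a ∧ j ∈ J a ∧ w[edgeTarget (w.map Prod.fst) (k, j)]? = some b ∧ P b

variable (P : UnitSlice T × A → Prop) (J : UnitSlice T × A → Set ℕ)

/-- Given whether the center of `S` satisfies `p` and which out-frontier vertices of `S` lead to a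
center with a given property, the in-frontier vertices of `S` leading to such a center. -/
def frontierStep (S : UnitSlice T) (p : Prop) (s : ℕ → Prop) (i : ℕ) : Prop :=
  if h : i < S.inn then (S.pass ⟨i, h⟩).elim p (fun j => s j) else p

theorem frontierStep_congr {S : UnitSlice T} {p : Prop} {s s' : ℕ → Prop}
    (h : ∀ j < S.out, s j ↔ s' j) : frontierStep S p s = frontierStep S p s' := by
  ext i
  rw [frontierStep, frontierStep]
  split_ifs with hi
  · rcases S.pass ⟨i, hi⟩ with - | j
    · rfl
    · exact h j j.2
  · rfl

theorem frontierHits_cons (a : UnitSlice T × A) (w : List (UnitSlice T × A)) :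
    FrontierHits P (a :: w) = frontierStep a.1 (P a) (FrontierHits P w) := by
  ext i
  by_cases hi : i < a.1.inn
  · rcases hj : a.1.pass ⟨i, hi⟩ with - | j <;>
      simp [FrontierHits, frontierStep, frontierTarget, hi, hj]
  · simp [FrontierHits, frontierStep, frontierTarget, hi]

theorem edgeHits_cons (a : UnitSlice T × A) (w : List (UnitSlice T × A)) :
    EdgeHits P J (a :: w) ↔ (∃ j ∈ J a, FrontierHits P w j) ∨ EdgeHits P J w := by
  rw [EdgeHits, ← Nat.or_exists_add_one]
  refine or_congr ?_ ?_
  · simp [edgeTarget_cons_zero, FrontierHits]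
  · simp [edgeTarget_cons_succ, EdgeHits]

/-- The transition function of an automaton deciding `EdgeHits`, from right to left: a state
consists of the in-frontier vertices satisfying `FrontierHits` and the truth value of `EdgeHits`. -/
def edgeHitsStep (c : ℕ) (a : UnitSlice T × A) (s : (Fin c → Prop) × Prop) :
    (Fin c → Prop) × Prop :=
  let hits (j : ℕ) := ∃ h : j < c, s.1 ⟨j, h⟩
  (fun i => frontierStep a.1 (P a) hits i, (∃ j ∈ J a, hits j) ∨ s.2)

theorem foldr_edgeHitsStep {c : ℕ} {w : List (UnitSlice T × A)} (hc : ∀ a ∈ w, a.1.out ≤ c)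
    (hJ : ∀ a ∈ w, ∀ j ∈ J a, j < a.1.out) :
    w.foldr (edgeHitsStep P J c) (fun _ => False, False) =
      (fun i : Fin c => FrontierHits P w i, EdgeHits P J w) := by
  induction w with
  | nil => simp [FrontierHits, EdgeHits]
  | cons a w ih =>
    rw [List.forall_mem_cons] at hc hJ
    rw [List.foldr_cons, ih hc.2 hJ.2]
    have hits_iff (j : ℕ) (hj : j < a.1.out) :
        (∃ _ : j < c, FrontierHits P w j) ↔ FrontierHits P w j :=
      exists_prop_of_true (hj.trans_le hc.1)
    simp only [edgeHitsStep, frontierHits_cons, edgeHits_cons, frontierStep_congr hits_iff]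
    congr! 3
    exact funext fun j => propext (and_congr_right fun hj => hits_iff j (hJ.1 j hj))

theorem exists_isRegular_edgeHits (c : ℕ) :
    ∃ L : Language (UnitSlice T × A), L.IsRegular ∧ ∀ w, (∀ a ∈ w, a.1.out ≤ c) →
      (∀ a ∈ w, ∀ j ∈ J a, j < a.1.out) → (w ∈ L ↔ EdgeHits P J w) :=
  ⟨{w | (w.foldr (edgeHitsStep P J c) (fun _ => False, False)).2},
    isRegular_of_foldr _ _ {s : _ × Prop | s.2} fun _ => Iff.rfl,
    fun _ hc hJ => iff_of_eq (congrArg Prod.snd (foldr_edgeHitsStep P J hc hJ))⟩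

end EdgeHits

namespace MSO₂

variable {T : Type u} {c n m p q n' m' p' q' : ℕ}

/-- Over `Σ(c, T)`, the truth of `φ` under an assignment is decided by a finite automaton reading
the slices of a unit decomposition together with the marking given by the assignment. -/
def Recognizable (c : ℕ) (φ : MSO₂ T n m p q) : Prop :=
  ∃ L : Language (UnitSlice T × Marking n m p q), L.IsRegular ∧
    ∀ U, (∀ S ∈ U, S ∈ sliceAlphabet c T) → ∀ (H : LDAG T) (f : Layout H U)
      (a : H.Assignment n m p q),
      φ.Sat H a.vertex a.edge a.vertexSet a.edgeSet ↔ mark U (f.marking a) ∈ L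

theorem Recognizable.of_exists_slice {φ : MSO₂ T n m p q}
    (P : UnitSlice T × Marking n m p q → Prop)
    (h : ∀ U (H : LDAG T) (f : Layout H U) (a : H.Assignment n m p q),
      φ.Sat H a.vertex a.edge a.vertexSet a.edgeSet ↔ ∃ k, P (U[k], f.marking a k)) :
    φ.Recognizable c :=
  ⟨_, isRegular_exists_mem P, fun U _ H f a => (h U H f a).trans exists_mem_mark.symm⟩

theorem recognizable_memV (x : Fin n) (X : Fin p) :
    (memV x X : MSO₂ T n m p q).Recognizable c :=
  .of_exists_slice (fun s => s.2.vertex x ∧ s.2.vertexSet X) fun _ _ f a => by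
    rw [← f.pos.exists_congr_right]
    simp [Sat, Layout.marking, Assignment.map]

theorem recognizable_lab (x : Fin n) (l : T) : (lab x l : MSO₂ T n m p q).Recognizable c :=
  .of_exists_slice (fun s => s.2.vertex x ∧ s.1.label = l) fun _ _ f a => by
    rw [← f.pos.exists_congr_right, Sat, ← f.label_pos]
    simp [Layout.marking, Assignment.map]

theorem recognizable_memE (y : Fin m) (Y : Fin q) :
    (memE y Y : MSO₂ T n m p q).Recognizable c :=
  .of_exists_slice (fun s => ∃ j ∈ s.2.edge y, j ∈ s.2.edgeSet Y) fun _ _ f a => by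
    refine ⟨fun h => ⟨_, _, (f.mem_outEdges_code {a.edge y} _).2 rfl,
      (f.mem_outEdges_code _ _).2 h⟩, ?_⟩
    rintro ⟨k, j, ⟨e, rfl, he⟩, e', he', h⟩
    obtain rfl := f.code.injective (Subtype.ext (he.trans h.symm))
    exact he'

theorem recognizable_src (y : Fin m) (x : Fin n) : (src y x : MSO₂ T n m p q).Recognizable c :=
  .of_exists_slice (fun s => s.2.vertex x ∧ (s.2.edge y).Nonempty) fun _ H f a => by
    have pos_src := f.pos_src (a.edge y)
    constructor
    · intro (h : H.src _ = _)
      refine ⟨f.pos (a.vertex x), (f.pos.symm_apply_apply _).symm, _, _, rfl, Prod.ext ?_ rfl⟩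
      exact pos_src.symm.trans (congrArg (fun v => (f.pos v : ℕ)) h)
    · rintro ⟨k, hx : a.vertex x = _, j, e, rfl, he⟩
      refine Eq.trans (f.pos.injective (Fin.ext ?_)) hx.symm
      rw [pos_src, he, f.pos.apply_symm_apply]

theorem recognizable_tgt (y : Fin m) (x : Fin n) : (tgt y x : MSO₂ T n m p q).Recognizable c := by
  obtain ⟨L, hL, mem_iff⟩ := exists_isRegular_edgeHits
    (fun s : UnitSlice T × Marking n m p q => s.2.vertex x) (fun s => s.2.edge y) c
  refine ⟨L, hL, fun U hU H f a => ?_⟩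
  have hc : ∀ s ∈ mark U (f.marking a), s.1.out ≤ c :=
    forall_mem_mark.2 fun k => (le_max_right _ _).trans (hU _ (List.getElem_mem k.2))
  have hJ : ∀ s ∈ mark U (f.marking a), ∀ j ∈ s.2.edge y, j < s.1.out :=
    forall_mem_mark.2 fun k j hj => (f.exists_outEdges_eq_iff.1 ⟨_, rfl⟩ k j hj).1
  rw [mem_iff _ hc hJ, EdgeHits, map_fst_mark]
  have pos_tgt := f.pos_tgt (a.edge y)
  simp only [getElem?_mark_eq_some]
  constructor
  · intro (h : H.tgt _ = _)
    refine ⟨_, _, _, _, ⟨(f.code (a.edge y)).fst_lt, rfl⟩, ⟨_, rfl, rfl⟩,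
      ⟨pos_tgt ▸ (f.pos (H.tgt (a.edge y))).2, rfl⟩, ?_⟩
    exact h.symm.trans ((Equiv.eq_symm_apply _).2 (Fin.ext pos_tgt))
  · rintro ⟨k, j, _, _, ⟨hk, rfl⟩, ⟨e, rfl, he⟩, ⟨hk', rfl⟩, hx : a.vertex x = _⟩
    rw [he] at pos_tgt
    exact ((Equiv.eq_symm_apply _).2 (Fin.ext pos_tgt)).trans hx.symm

theorem Recognizable.and {φ ψ : MSO₂ T n m p q} :
    φ.Recognizable c → ψ.Recognizable c → (φ.and ψ).Recognizable c :=
  fun ⟨_, hL, mem_L⟩ ⟨_, hK, mem_K⟩ => ⟨_, hL.inf hK, fun U hU H f a =>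
    and_congr (mem_L U hU H f a) (mem_K U hU H f a)⟩

theorem Recognizable.or {φ ψ : MSO₂ T n m p q} :
    φ.Recognizable c → ψ.Recognizable c → (φ.or ψ).Recognizable c :=
  fun ⟨_, hL, mem_L⟩ ⟨_, hK, mem_K⟩ => ⟨_, hL.add hK, fun U hU H f a =>
    or_congr (mem_L U hU H f a) (mem_K U hU H f a)⟩

theorem Recognizable.not {φ : MSO₂ T n m p q} : φ.Recognizable c → φ.not.Recognizable c :=
  fun ⟨_, hL, mem_L⟩ => ⟨_, hL.compl, fun U hU H f a => not_congr (mem_L U hU H f a)⟩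

theorem Recognizable.of_exists_assignment {φ : MSO₂ T n m p q} {ψ : MSO₂ T n' m' p' q'}
    (hψ : ψ.Recognizable c)
    (d : ∀ {α β γ δ : Type}, Assignment α β γ δ n' m' p' q' → Assignment α β γ δ n m p q)
    (d_map : ∀ {α β γ δ α' β' γ' δ' : Type} (g : α → α') (h : β → β') (i : γ → γ') (j : δ → δ')
      (a : Assignment α β γ δ n' m' p' q'), d (a.map g h i j) = (d a).map g h i j)
    (hφ : ∀ (H : LDAG T) (a : H.Assignment n m p q),
      φ.Sat H a.vertex a.edge a.vertexSet a.edgeSet ↔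
        ∃ a' : H.Assignment n' m' p' q', d a' = a ∧
          ψ.Sat H a'.vertex a'.edge a'.vertexSet a'.edgeSet) : φ.Recognizable c := by
  obtain ⟨L, hL, mem_L⟩ := hψ
  refine ⟨Language.map (Prod.map id d) (assignmentMarkings T n' m' p' q' ⊓ L),
    isRegular_map ((isRegular_assignmentMarkings ..).inf hL) _, fun U hU H f a => ?_⟩
  have comp_marking (a' : H.Assignment n' m' p' q') : d ∘ f.marking a' = f.marking (d a') :=
    funext fun _ => d_map ..
  rw [hφ, mark_mem_map_iff]
  constructor
  · rintro ⟨a', rfl, ha'⟩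
    exact ⟨f.marking a', comp_marking a', f.exists_marking_eq_iff.1 ⟨a', rfl⟩,
      (mem_L U hU H f a').1 ha'⟩
  · rintro ⟨g, hg, hg_mem, hgL⟩
    obtain ⟨a', rfl⟩ := f.exists_marking_eq_iff.2 hg_mem
    exact ⟨a', f.marking_injective ((comp_marking a').symm.trans hg), (mem_L U hU H f a').2 hgL⟩

theorem Recognizable.exV {φ : MSO₂ T (n + 1) m p q} (hφ : φ.Recognizable c) :
    φ.exV.Recognizable c :=
  hφ.of_exists_assignment Assignment.dropVertex (fun _ _ _ _ _ => rfl) fun _ a =>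
    ⟨fun ⟨v, hv⟩ => ⟨⟨Fin.cons v a.vertex, a.edge, a.vertexSet, a.edgeSet⟩, rfl, hv⟩, by
      rintro ⟨a', rfl, ha'⟩
      exact ⟨a'.vertex 0, (Fin.cons_self_tail a'.vertex).symm ▸ ha'⟩⟩

theorem Recognizable.exE {φ : MSO₂ T n (m + 1) p q} (hφ : φ.Recognizable c) :
    φ.exE.Recognizable c :=
  hφ.of_exists_assignment Assignment.dropEdge (fun _ _ _ _ _ => rfl) fun _ a =>
    ⟨fun ⟨e, he⟩ => ⟨⟨a.vertex, Fin.cons e a.edge, a.vertexSet, a.edgeSet⟩, rfl, he⟩, by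
      rintro ⟨a', rfl, ha'⟩
      exact ⟨a'.edge 0, (Fin.cons_self_tail a'.edge).symm ▸ ha'⟩⟩

theorem Recognizable.exVS {φ : MSO₂ T n m (p + 1) q} (hφ : φ.Recognizable c) :
    φ.exVS.Recognizable c :=
  hφ.of_exists_assignment Assignment.dropVertexSet (fun _ _ _ _ _ => rfl) fun _ a =>
    ⟨fun ⟨X, hX⟩ => ⟨⟨a.vertex, a.edge, Fin.cons X a.vertexSet, a.edgeSet⟩, rfl, hX⟩, by
      rintro ⟨a', rfl, ha'⟩
      exact ⟨a'.vertexSet 0, (Fin.cons_self_tail a'.vertexSet).symm ▸ ha'⟩⟩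

theorem Recognizable.exES {φ : MSO₂ T n m p (q + 1)} (hφ : φ.Recognizable c) :
    φ.exES.Recognizable c :=
  hφ.of_exists_assignment Assignment.dropEdgeSet (fun _ _ _ _ _ => rfl) fun _ a =>
    ⟨fun ⟨Y, hY⟩ => ⟨⟨a.vertex, a.edge, a.vertexSet, Fin.cons Y a.edgeSet⟩, rfl, hY⟩, by
      rintro ⟨a', rfl, ha'⟩
      exact ⟨a'.edgeSet 0, (Fin.cons_self_tail a'.edgeSet).symm ▸ ha'⟩⟩

theorem recognizable (c : ℕ) (φ : MSO₂ T n m p q) : φ.Recognizable c := by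
  induction φ with
  | memV x X => exact recognizable_memV x X
  | memE y Y => exact recognizable_memE y Y
  | src y x => exact recognizable_src y x
  | tgt y x => exact recognizable_tgt y x
  | lab x l => exact recognizable_lab x l
  | and _ _ hφ hψ => exact hφ.and hψ
  | or _ _ hφ hψ => exact hφ.or hψ
  | not _ hφ => exact hφ.not
  | exV _ hφ => exact hφ.exV
  | exE _ hφ => exact hφ.exE
  | exVS _ hφ => exact hφ.exVS
  | exES _ hφ => exact hφ.exES

end MSO₂

/-! ## Slice automata -/

section Automaton

variable {T : Type u} {σ : Type}

/-- The automaton which, started in `(s, k)`, accepts the composable sequences of unit slices over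
`Σ(c, T)` which `M` accepts from `s` and whose first slice has `k` in-frontier vertices; besides the
state of `M` it remembers the number of out-frontier vertices of the last slice. -/
def frontierNFA (c : ℕ) (M : DFA (UnitSlice T) σ) : NFA (UnitSlice T) (σ × Fin (c + 1)) where
  step q S := {q' | S ∈ sliceAlphabet c T ∧ S.inn = q.2 ∧ q'.1 = M.step q.1 S ∧ (q'.2 : ℕ) = S.out}
  start := {(M.start, 0)}
  accept := {q | q.1 ∈ M.accept ∧ q.2 = 0}

theorem mem_acceptsFrom_frontierNFA {c : ℕ} (M : DFA (UnitSlice T) σ) (s : σ) (k : Fin (c + 1))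
    (U : List (UnitSlice T)) : U ∈ (frontierNFA c M).acceptsFrom {(s, k)} ↔
      (∀ S ∈ U, S ∈ sliceAlphabet c T) ∧ ComposableFrom k U ∧ M.evalFrom s U ∈ M.accept := by
  induction U generalizing s k with
  | nil => simp [frontierNFA, ComposableFrom, and_comm]
  | cons S U ih =>
    rw [cons_mem_acceptsFrom_singleton, List.forall_mem_cons, ComposableFrom, DFA.evalFrom_cons]
    constructor
    · rintro ⟨⟨s', k'⟩, ⟨hS, hk, rfl, hk'⟩, h⟩
      obtain ⟨hU, hcomp, hM⟩ := (ih _ _).1 h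
      exact ⟨⟨hS, hU⟩, ⟨hk, hk' ▸ hcomp⟩, hM⟩
    · rintro ⟨⟨hS, hU⟩, ⟨hk, hcomp⟩, hM⟩
      have hout : S.out < c + 1 := Nat.lt_succ_of_le ((le_max_right _ _).trans hS)
      exact ⟨(_, ⟨S.out, hout⟩), ⟨hS, hk, rfl, rfl⟩, (ih _ _).2 ⟨hU, hcomp, hM⟩⟩

/-- The slice automaton accepting the unit decompositions over `Σ(c, T)` accepted by `M`. -/
def sliceAutomatonOfDFA [Finite σ] (c : ℕ) (M : DFA (UnitSlice T) σ) : SliceAutomaton c T where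
  Q := σ × Fin (c + 1)
  finQ := inferInstance
  Δ := {t | t.2.2 ∈ (frontierNFA c M).step t.1 t.2.1}
  q₀ := (M.start, 0)
  F := (frontierNFA c M).accept
  alphabet _ _ _ h := h.1
  initial _ _ h := h.2.1
  final _ _ _ h hF := h.2.2.2.symm.trans (congrArg Fin.val hF.2)
  glue _ _ _ _ _ h h' := h.2.2.2.symm.trans h'.2.1.symm

theorem lang_sliceAutomatonOfDFA [Finite σ] (c : ℕ) (M : DFA (UnitSlice T) σ) :
    (sliceAutomatonOfDFA c M).lang = {U ∈ unitDecompositions c T | U ∈ M.accepts} := by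
  ext U
  refine (mem_acceptsFrom_frontierNFA M M.start 0 U).trans ?_
  rw [← and_assoc]
  exact and_congr_left' (and_congr_right' isUnitDecomposition_iff_composableFrom.symm)

theorem MSO₂.exists_defines (c : ℕ) (ψ : MSO₂Sentence T) :
    ∃ A : SliceAutomaton c T, A.Defines ψ := by
  obtain ⟨L, ⟨σ, _, M, rfl⟩, hL⟩ := ψ.recognizable c
  let blank : Marking 0 0 0 0 := ⟨![], ![], ![], ![]⟩
  refine ⟨sliceAutomatonOfDFA c (M.comap fun S => (S, blank)), ?_⟩
  rw [SliceAutomaton.Defines, lang_sliceAutomatonOfDFA]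
  ext U
  refine and_congr_right fun hU => ?_
  obtain ⟨f⟩ := hU.2.nonempty_layout
  let a : (composed U).Assignment 0 0 0 0 := ⟨![], ![], ![], ![]⟩
  have map_blank_eq : U.map (fun S => (S, blank)) = mark U (f.marking a) := by
    have marking_eq (k) : f.marking a k = blank := by ext1 <;> exact Subsingleton.elim _ _
    simp only [mark, marking_eq]
    exact (List.ofFn_getElem_eq_map U _).symm
  rw [LDAG.Models, hL U hU.1 _ f a, ← map_blank_eq, DFA.mem_accepts, DFA.eval_comap]
  rfl

end Automaton

/-! ## Saturation and partial order languages -/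

namespace SliceAutomaton.Defines

variable {T : Type u} {c : ℕ} {ψ : MSO₂Sentence T} {A : SliceAutomaton c T}

theorem mem_lang_iff (hA : A.Defines ψ) (hc : ∀ H : LDAG T, H.Models ψ → H.CoverableBy c)
    {U : List (UnitSlice T)} : U ∈ A.lang ↔ IsUnitDecomposition U ∧ (composed U).Models ψ := by
  rw [hA]
  exact ⟨fun h => ⟨h.1.2, h.2⟩, fun h => ⟨⟨fun _ => h.1.mem_sliceAlphabet (hc _ h.2), h.1⟩, h.2⟩⟩

theorem isSaturated (hA : A.Defines ψ) (hc : ∀ H : LDAG T, H.Models ψ → H.CoverableBy c) :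
    A.IsSaturated := by
  rintro H ⟨U, hU, ⟨f⟩⟩ U' hU'
  obtain ⟨_, hU', ⟨g⟩⟩ := Set.mem_iUnion.1 hU'
  rw [hA.mem_lang_iff hc] at hU ⊢
  exact ⟨hU'.2, ((f.trans g.symm).models_iff ψ).1 hU.2⟩

theorem isTransReduced (hA : A.Defines ψ)
    (hψ : ∀ H : LDAG T, H.Models ψ → H.IsTransReduced) : A.IsTransReduced := by
  rintro H ⟨U, hU, ⟨f⟩⟩
  rw [hA] at hU
  exact hψ H ((f.models_iff ψ).1 hU.2)

theorem poLanguage_eq (hA : A.Defines ψ) (hc : ∀ H : LDAG T, H.Models ψ → H.CoverableBy c)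
    (hψ : ∀ H : LDAG T, H.Models ψ → H.IsTransReduced) :
    poLanguage A.lang = {ℓ | ℓ.hasse.Models ψ} := by
  ext ℓ
  constructor
  · rintro ⟨U, hU, hℓ⟩
    have hU := ((hA.mem_lang_iff hc).1 hU).2
    obtain ⟨f⟩ := (hψ _ hU).iso_hasse_tc
    obtain ⟨g⟩ := hℓ.hasse_iso
    exact ((f.trans g).models_iff ψ).1 hU
  · intro hℓ
    obtain ⟨U, hU, ⟨f⟩⟩ := ℓ.hasse.exists_isUnitDecomposition
    exact ⟨U, (hA.mem_lang_iff hc).2 ⟨hU, (f.models_iff ψ).2 hℓ⟩, f.tc_isIso.trans ℓ.hasse_tc_isIso⟩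

end SliceAutomaton.Defines

theorem LDAG.models_gr_and_rho_and_gamma_iff {T : Type u} (H : LDAG T) (c : ℕ) (φ : MSOSentence T) :
    H.Models (.and φ.gr (.and MSO₂.rho (MSO₂.gamma c))) ↔
      H.Models φ.gr ∧ H.IsTransReduced ∧ H.CoverableBy c :=
  and_congr_right' (and_congr H.models_rho_iff (H.models_gamma_iff c))

theorem mainTheorem7_general {T : Type u} (c : ℕ) (φ : MSOSentence T) :
    (∀ ℓ : LPO T, ℓ.Models φ ↔ ℓ.hasse.Models φ.gr) ∧
    (∀ H : LDAG T, H.Models MSO₂.rho ↔ H.IsTransReduced) ∧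
    (∀ H : LDAG T, H.Models (MSO₂.gamma c) ↔ H.CoverableBy c) ∧
    (∃ A : SliceAutomaton c T, A.Defines (.and φ.gr (.and MSO₂.rho (MSO₂.gamma c)))) ∧
    ∀ A : SliceAutomaton c T, A.Defines (.and φ.gr (.and MSO₂.rho (MSO₂.gamma c))) →
      A.IsSaturated ∧ A.IsTransReduced ∧ poLanguage A.lang = cPartialOrders c T φ := by
  have models_iff (H : LDAG T) := H.models_gr_and_rho_and_gamma_iff c φ
  have coverableBy (H : LDAG T) (h : H.Models _) : H.CoverableBy c := ((models_iff H).1 h).2.2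
  have isTransReduced (H : LDAG T) (h : H.Models _) : H.IsTransReduced := ((models_iff H).1 h).2.1
  have models_hasse_iff (ℓ : LPO T) : ℓ.hasse.Models _ ↔ ℓ ∈ cPartialOrders c T φ :=
    (models_iff ℓ.hasse).trans
      ⟨fun ⟨hφ, _, hc⟩ => ⟨hc, (ℓ.models_iff_hasse_models φ).2 hφ⟩,
        fun ⟨hc, hφ⟩ => ⟨(ℓ.models_iff_hasse_models φ).1 hφ, ℓ.hasse_isTransReduced, hc⟩⟩
  exact ⟨fun ℓ => ℓ.models_iff_hasse_models φ, LDAG.models_rho_iff, fun H => H.models_gamma_iff c,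
    MSO₂.exists_defines c _, fun A hA => ⟨hA.isSaturated coverableBy,
      hA.isTransReduced isTransReduced,
      (hA.poLanguage_eq coverableBy isTransReduced).trans (Set.ext models_hasse_iff)⟩⟩

theorem mainTheorem7 {T : Type u} [Finite T] (c : ℕ) (φ : MSOSentence T) :
    -- the meaning of the three sentences `φ.gr`, `rho` and `gamma c`
    (∀ ℓ : LPO T, ℓ.Models φ ↔ ℓ.hasse.Models φ.gr) ∧
    (∀ H : LDAG T, H.Models MSO₂.rho ↔ H.IsTransReduced) ∧
    (∀ H : LDAG T, H.Models (MSO₂.gamma c) ↔ H.CoverableBy c) ∧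
    -- the slice automaton of their conjunction exists
    (∃ A : SliceAutomaton c T, A.Defines (.and φ.gr (.and MSO₂.rho (MSO₂.gamma c)))) ∧
    -- and has the asserted properties, however it is constructed
    ∀ A : SliceAutomaton c T, A.Defines (.and φ.gr (.and MSO₂.rho (MSO₂.gamma c))) →
      A.IsSaturated ∧ A.IsTransReduced ∧ poLanguage A.lang = cPartialOrders c T φ :=
  mainTheorem7_general c φ
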